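/- Let $V^\natural$ be the moonshine module vertex operator algebra over $\mathbb{C}$, i.e. up to isomorphism the holomorphic vertex operator algebra of central charge $24$ with $V^\natural_n=0$ for $n<0$, $V^\natural_0=\mathbb{C}\mathbf{1}$, $V^\natural_1=0$ whose conformal vector is a sum of $48$ mutually orthogonal Ising vectors. Let $\mathbb{M}=\mathrm{Aut}(V^\natural)$ be the Monster. For $g\in\mathbb{M}$ put $$T_g(\tau)=\sum_{n\ge 0}\mathrm{Tr}(g|_{V^\natural_n})\,q^{n-1},\qquad q=e^{2\pi i\tau},\ \mathrm{Im}\,\tau>0 .$$ Call $g$ Fricke if $T_g(-1/(M\tau))=T_g(\tau)$ for some integer $M\ge 1$, and non-Fricke otherwise. Let $g\in\mathbb{M}$ be non-Fricke, and let $N\ge 1$ be an integer and $(c(m,0))_{m\ge1}$, $(c(1,n/N))_{n\ge 1}$ the sequences of non-negative integers attached to $g$: for a constant $\kappa\in\mathbb{C}$ and all $\tau$ in the upper half-plane, $$T_g(\tau)+\kappa=q^{-1}\prod_{m>0}(1-q^m)^{c(m,0)},\qquad T_g(-1/\tau)+\kappa=\sum_{n>0}c(1,n/N)\,q^{n/N},\qquad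 c(1,1/N)\neq 0 .$$ Put $I_-=\{(-m,j)\in\mathbb{Z}^2: m>0,\ 1\le j\le c(m,0)\}$, $I_+=\{(n,k)\in\mathbb{Z}^2: n>0,\ 1\le k\le c(1,n/N)\}$, $I=I_-\cup I_+$, and let $A_g=(a_{ij})_{i,j\in I}$ be the symmetric matrix with $a_{(-m,j),(-n,k)}=0$ on $I_-\times I_-$, $a_{(-m,j),(n,k)}=a_{(n,k),(-m,j)}=-mn$ for $(-m,j)\in I_-$ and $(n,k)\in I_+$, and $a_{(m,j),(n,k)}=-(m+n)$ on $I_+\times I_+$. Let $\mathfrak{g}(A_g)$ be the Borcherds algebra of $A_g$: the complex Lie algebra with generators $e_i,f_i,h_i$ $(i\in I)$ and relations $[h_i,h_j]=0$, $[h_i,e_j]=a_{ij}e_j$, $[h_i,f_j]=-a_{ij}f_j$, $[e_i,f_j]=\delta_{ij}h_i$; $(\mathrm{ad}\,e_i)^{1-2a_{ij}/a_{ii}}e_j=(\mathrm{ad}\,f_i)^{1-2a_{ij}/a_{ii}}f_j=0$ if $i\ne j$ and $a_{ii}>0$; and $[e_i,e_j]=[f_i,f_j]=0$ if $a_{ij}=0$.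 Let $\mathfrak{z}$ be its center and $\mathfrak{m}_g=\mathfrak{g}(A_g)/\mathfrak{z}$. Fix any total order on $I_-$, and let $\mathfrak{u}^+$ (resp. $\mathfrak{u}^-$) be the Lie subalgebra of $\mathfrak{g}(A_g)$ generated by the elements $$\mathrm{ad}(x_{j_1})^{l_1}\cdots\mathrm{ad}(x_{j_n})^{l_n}x_i,\qquad n\ge 0,\ j_1<\dots<j_n\in I_-,\ l_k>0,\ i\in I_+,$$ with $x=e$ (resp. $x=f$). Then there is a least $\ell>0$ with $c(\ell,0)\ne0$. The Lie algebras $\mathfrak{u}^\pm$ are freely generated by the displayed elements, and they map injectively to $\mathfrak{m}_g$. Identifying $\mathfrak{u}^\pm$ with their images, and writing $e_i,f_i,h_i$ also for the images of the generators in $\mathfrak{m}_g$, one has the decomposition of vector spaces $$\mathfrak{m}_g=\mathfrak{u}^-\oplus\mathcal{H}\oplus\mathbb{C}h_{(1,1)}\oplus\mathfrak{u}^+,\qquad h_{(1,1)}\ne 0,$$ where $\mathcal{H}$, the span of $\{e_i,f_i\}_{i\in I_-}$ and $h_{(-\ell,1)}$, is a Lie subalgebra and an infinite-dimensional Heisenberg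 Lie algebra (its derived subalgebra equals its center, which is one-dimensional), with center $\mathbb{C}h_{(-\ell,1)}$. -/

import Mathlib

noncomputable section

universe u v

/-! ## Vertex operator algebras over the complex numbers -/

/-- The Borcherds (Jacobi) identity for mode operators `Y a n = a_(n)` on `V`, acting on a space `M`
through mode operators `YM a n`. The sums over `j` are finite as soon as the truncation condition
holds. For `M = V` and `YM = Y` this is the identity of a vertex algebra. -/
def BorcherdsIdentity {V : Type u} {M : Type v} [AddCommGroup V] [Module ℂ V]
    [AddCommGroup M] [Module ℂ M]
    (Y : V →ₗ[ℂ] (ℤ → Module.End ℂ V)) (YM : V →ₗ[ℂ] (ℤ → Module.End ℂ M)) : Prop :=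
  ∀ (a b : V) (w : M) (k m n : ℤ),
    (∑ᶠ j : ℕ, ((Ring.choose m j : ℤ) : ℂ) • YM (Y a (n + j) b) (m + k - j) w) =
      ∑ᶠ j : ℕ, ((-1 : ℂ) ^ j * ((Ring.choose n j : ℤ) : ℂ)) •
        (YM a (m + n - j) (YM b (k + j) w) - (-1 : ℂ) ^ n • YM b (n + k - j) (YM a (m + j) w))

/-- The operators `L n = e_(n+1)` satisfy the Virasoro relations with central charge `c`. -/
def IsVirasoro {V : Type u} [AddCommGroup V] [Module ℂ V]
    (Y : V →ₗ[ℂ] (ℤ → Module.End ℂ V)) (e : V) (c : ℂ) : Prop :=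
  ∀ m n : ℤ,
    Y e (m + 1) * Y e (n + 1) - Y e (n + 1) * Y e (m + 1) =
      ((m : ℂ) - n) • Y e (m + n + 1) +
        (if m + n = 0 then ((m : ℂ) ^ 3 - m) / 12 * c else 0) • (1 : Module.End ℂ V)

/-- A vertex operator algebra structure on a complex vector space `V`: `Y a n` is the mode `a_(n)`
in `Y(a, z) = ∑ a_(n) z^(-n-1)`. -/
structure VertexOperatorAlgebra (V : Type u) [AddCommGroup V] [Module ℂ V] where
  /-- the modes -/
  Y : V →ₗ[ℂ] (ℤ → Module.End ℂ V)
  /-- the vacuum -/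
  vac : V
  /-- the conformal vector -/
  conf : V
  /-- the central charge -/
  rank : ℂ
  truncation : ∀ a b : V, ∃ n₀ : ℤ, ∀ n, n₀ ≤ n → Y a n b = 0
  vacuum : ∀ (n : ℤ) (b : V), Y vac n b = if n = -1 then b else 0
  creation : ∀ a : V, Y a (-1) vac = a ∧ ∀ n : ℤ, 0 ≤ n → Y a n vac = 0
  borcherds : BorcherdsIdentity Y Y
  virasoro : IsVirasoro Y conf rank
  derivative : ∀ (a : V) (n : ℤ), Y (Y conf 0 a) n = -(n : ℂ) • Y a (n - 1)
  grading : (⨆ n : ℤ, Module.End.eigenspace (Y conf 1) (n : ℂ)) = ⊤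
  finite_dim : ∀ n : ℤ, FiniteDimensional ℂ (Module.End.eigenspace (Y conf 1) (n : ℂ))
  bounded_below : ∃ n₀ : ℤ, ∀ n, n < n₀ → Module.End.eigenspace (Y conf 1) (n : ℂ) = ⊥

/-- The mode operators `YM` leave no subspace of the nonzero space `M` invariant, except the two
trivial ones. -/
def IsIrreducibleAction {V : Type u} {M : Type v} [AddCommGroup V] [Module ℂ V]
    [AddCommGroup M] [Module ℂ M] (YM : V →ₗ[ℂ] (ℤ → Module.End ℂ M)) : Prop :=
  Nontrivial M ∧
    ∀ W : Submodule ℂ M, (∀ (a : V) (n : ℤ), ∀ w ∈ W, YM a n w ∈ W) → W = ⊥ ∨ W = ⊤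

namespace VertexOperatorAlgebra

variable {V : Type u} [AddCommGroup V] [Module ℂ V] (𝒱 : VertexOperatorAlgebra V)

/-- The homogeneous subspace `V_n` of weight `n`, the eigenspace of `L(0)`. -/
def weightSpace (n : ℤ) : Submodule ℂ V := Module.End.eigenspace (𝒱.Y 𝒱.conf 1) (n : ℂ)

/-- `YM` is the structure of an (ordinary) module over the vertex operator algebra on `M`: the
space `M` is the sum of finite-dimensional `L(0)`-eigenspaces, and the weights are bounded below in
each coset of `ℤ`. -/
structure IsModule {M : Type v} [AddCommGroup M] [Module ℂ M]
    (YM : V →ₗ[ℂ] (ℤ → Module.End ℂ M)) : Prop where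
  truncation : ∀ (a : V) (w : M), ∃ n₀ : ℤ, ∀ n, n₀ ≤ n → YM a n w = 0
  vacuum : ∀ (n : ℤ) (w : M), YM 𝒱.vac n w = if n = -1 then w else 0
  borcherds : BorcherdsIdentity 𝒱.Y YM
  grading : (⨆ r : ℂ, Module.End.eigenspace (YM 𝒱.conf 1) r) = ⊤
  finite_dim : ∀ r : ℂ, FiniteDimensional ℂ (Module.End.eigenspace (YM 𝒱.conf 1) r)
  bounded_below : ∀ r : ℂ, ∃ n₀ : ℤ, ∀ n, n < n₀ →
    Module.End.eigenspace (YM 𝒱.conf 1) (r + n) = ⊥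

/-- The adjoint module is irreducible, and it is the only irreducible module. -/
def IsHolomorphic : Prop :=
  IsIrreducibleAction 𝒱.Y ∧
    ∀ (M : Type u) [AddCommGroup M] [Module ℂ M] (YM : V →ₗ[ℂ] (ℤ → Module.End ℂ M)),
      𝒱.IsModule YM → IsIrreducibleAction YM →
        ∃ φ : V ≃ₗ[ℂ] M, ∀ (a b : V) (n : ℤ), φ (𝒱.Y a n b) = YM a n (φ b)

/-- The subalgebra generated by `e`: the smallest subspace that contains the vacuum and is stable
under all modes of `e`. -/
def generated (e : V) : Submodule ℂ V :=
  sInf {S | 𝒱.vac ∈ S ∧ ∀ n : ℤ, ∀ w ∈ S, 𝒱.Y e n w ∈ S}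

/-- An Ising vector: a weight-two Virasoro vector of central charge `1/2` that generates a simple
Virasoro vertex algebra `L(1/2, 0)`. -/
structure IsIsing (e : V) : Prop where
  weight_two : e ∈ 𝒱.weightSpace 2
  virasoro : IsVirasoro 𝒱.Y e (1 / 2)
  simple : ∀ W : Submodule ℂ V, W ≤ 𝒱.generated e → (∀ n : ℤ, ∀ w ∈ W, 𝒱.Y e n w ∈ W) →
    W = ⊥ ∨ W = 𝒱.generated e

/-- The moonshine module vertex operator algebra `V^♮`, characterised up to isomorphism (Lam and
Yamauchi): the holomorphic vertex operator algebra of central charge `24` with `V_0 = ℂ 1` and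
`V_1 = 0` whose conformal vector is a sum of `48` mutually orthogonal Ising vectors (a Virasoro
frame). -/
structure IsMoonshineModule : Prop where
  rank_eq : 𝒱.rank = 24
  weight_neg : ∀ n : ℤ, n < 0 → 𝒱.weightSpace n = ⊥
  weight_zero : 𝒱.weightSpace 0 = Submodule.span ℂ {𝒱.vac}
  weight_one : 𝒱.weightSpace 1 = ⊥
  holomorphic : 𝒱.IsHolomorphic
  framed : ∃ e : Fin 48 → V, (∀ i, 𝒱.IsIsing (e i)) ∧
    (∀ i j, i ≠ j → ∀ m n : ℤ, Commute (𝒱.Y (e i) m) (𝒱.Y (e j) n)) ∧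
    ∑ i, e i = 𝒱.conf

/-- The automorphism group. For the moonshine module this is the Monster. -/
def automorphismGroup : Subgroup (V ≃ₗ[ℂ] V) where
  carrier := {g | (∀ (a b : V) (n : ℤ), g (𝒱.Y a n b) = 𝒱.Y (g a) n (g b)) ∧
    g 𝒱.vac = 𝒱.vac ∧ g 𝒱.conf = 𝒱.conf}
  mul_mem' := by
    rintro g h ⟨h1, h2, h3⟩ ⟨k1, k2, k3⟩
    refine ⟨fun a b n => ?_, ?_, ?_⟩
    · simp [LinearEquiv.mul_apply, k1, h1]
    · simp [LinearEquiv.mul_apply, k2, h2]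
    · simp [LinearEquiv.mul_apply, k3, h3]
  one_mem' := ⟨fun _ _ _ => rfl, rfl, rfl⟩
  inv_mem' := by
    rintro g ⟨h1, h2, h3⟩
    refine ⟨fun a b n => ?_, ?_, ?_⟩
    · apply g.injective
      rw [h1]
      change g (g.symm _) = 𝒱.Y (g (g.symm _)) n (g (g.symm _))
      simp
    · exact g.injective (by rw [h2]; exact g.apply_symm_apply _)
    · exact g.injective (by rw [h3]; exact g.apply_symm_apply _)

theorem automorphism_mem_weightSpace (g : 𝒱.automorphismGroup) (n : ℤ) :
    ∀ x ∈ 𝒱.weightSpace n, (g.1 : V →ₗ[ℂ] V) x ∈ 𝒱.weightSpace n := by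
  intro x hx
  obtain ⟨h1, -, h3⟩ := g.2
  unfold weightSpace at hx ⊢
  rw [Module.End.mem_eigenspace_iff] at hx ⊢
  have := h1 𝒱.conf x 1
  rw [h3, hx] at this
  simpa using this.symm

/-- The trace of an automorphism on the weight space `V_n`. -/
def weightTrace (g : 𝒱.automorphismGroup) (n : ℤ) : ℂ :=
  LinearMap.trace ℂ (𝒱.weightSpace n)
    ((g.1 : V →ₗ[ℂ] V).restrict (𝒱.automorphism_mem_weightSpace g n))

/-- The McKay--Thompson series `T_g(τ) = ∑_{n ≥ 0} Tr(g | V_n) q^(n-1)`, with `q = exp(2πiτ)`. -/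
def mckayThompson (g : 𝒱.automorphismGroup) (τ : ℂ) : ℂ :=
  ∑' n : ℕ, 𝒱.weightTrace g n * Complex.exp (2 * Real.pi * Complex.I * τ * ((n : ℂ) - 1))

/-- `T_g` is invariant under `τ ↦ -1/(Nτ)` on the upper half-plane for some `N ≥ 1`. -/
def IsFricke (g : 𝒱.automorphismGroup) : Prop :=
  ∃ N : ℕ, 0 < N ∧ ∀ τ : ℂ, 0 < τ.im →
    𝒱.mckayThompson g (-1 / (N * τ)) = 𝒱.mckayThompson g τ

/-- The sequences `c₀ m = c(m, 0)` and `c₁ n = c(1, n/N)`, for `m, n ≥ 1`, are those attached to `g`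
by the expansions of `T_g` at the two cusps:
`T_g(τ) + κ = q^(-1) ∏_{m > 0} (1 - q^m)^(c(m,0))` and
`T_g(-1/τ) + κ = ∑_{n > 0} c(1,n/N) q^(n/N)`, where `c(1,1/N) ≠ 0`. The constant `κ` normalises
the constant term of `T_g` so that `T_g(-1/τ) + κ` vanishes at the cusp. -/
structure IsMonstrousPair (g : 𝒱.automorphismGroup) (N : ℕ) (c₀ c₁ : ℕ → ℕ) : Prop where
  pos : 0 < N
  first_ne_zero : c₁ 1 ≠ 0
  expansions : ∃ κ : ℂ, ∀ τ : ℂ, 0 < τ.im →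
    HasProd
      (fun m : ℕ =>
        (1 - Complex.exp (2 * Real.pi * Complex.I * τ * ((m : ℂ) + 1))) ^ c₀ (m + 1))
      (Complex.exp (2 * Real.pi * Complex.I * τ) * (𝒱.mckayThompson g τ + κ)) ∧
    HasSum
      (fun n : ℕ =>
        (c₁ (n + 1) : ℂ) * Complex.exp (2 * Real.pi * Complex.I * τ * (((n : ℂ) + 1) / N)))
      (𝒱.mckayThompson g (-1 / τ) + κ)

end VertexOperatorAlgebra

/-! ## Borcherds algebras -/

/-- The symbols `e i`, `f i`, `h i`. -/
inductive BorcherdsGenerator (I : Type u) : Type u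
  | e : I → BorcherdsGenerator I
  | f : I → BorcherdsGenerator I
  | h : I → BorcherdsGenerator I

section Borcherds

variable {I : Type u}

/-- `e_i` as an element of the free Lie algebra. -/
abbrev freeE (i : I) : FreeLieAlgebra ℂ (BorcherdsGenerator I) :=
  FreeLieAlgebra.of ℂ (BorcherdsGenerator.e i)

/-- `f_i` as an element of the free Lie algebra. -/
abbrev freeF (i : I) : FreeLieAlgebra ℂ (BorcherdsGenerator I) :=
  FreeLieAlgebra.of ℂ (BorcherdsGenerator.f i)

/-- `h_i` as an element of the free Lie algebra. -/
abbrev freeH (i : I) : FreeLieAlgebra ℂ (BorcherdsGenerator I) :=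
  FreeLieAlgebra.of ℂ (BorcherdsGenerator.h i)

/-- The defining relators of the Borcherds algebra of a real matrix `A` (a symmetrized Borcherds
Cartan matrix): the elements that become zero. -/
inductive BorcherdsRelator (A : Matrix I I ℝ) : FreeLieAlgebra ℂ (BorcherdsGenerator I) → Prop
  | h_h (i j : I) : BorcherdsRelator A ⁅freeH i, freeH j⁆
  | h_e (i j : I) : BorcherdsRelator A (⁅freeH i, freeE j⁆ - (A i j : ℂ) • freeE j)
  | h_f (i j : I) : BorcherdsRelator A (⁅freeH i, freeF j⁆ + (A i j : ℂ) • freeF j)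
  | e_f_same (i : I) : BorcherdsRelator A (⁅freeE i, freeF i⁆ - freeH i)
  | e_f_ne (i j : I) : i ≠ j → BorcherdsRelator A ⁅freeE i, freeF j⁆
  | serre_e (i j : I) (k : ℕ) : i ≠ j → 0 < A i i → (k : ℝ) = 1 - 2 * A i j / A i i →
      BorcherdsRelator A ((LieAlgebra.ad ℂ (FreeLieAlgebra ℂ (BorcherdsGenerator I)) (freeE i) ^ k) (freeE j))
  | serre_f (i j : I) (k : ℕ) : i ≠ j → 0 < A i i → (k : ℝ) = 1 - 2 * A i j / A i i →
      BorcherdsRelator A ((LieAlgebra.ad ℂ (FreeLieAlgebra ℂ (BorcherdsGenerator I)) (freeF i) ^ k) (freeF j))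
  | orthogonal_e (i j : I) : A i j = 0 → BorcherdsRelator A ⁅freeE i, freeE j⁆
  | orthogonal_f (i j : I) : A i j = 0 → BorcherdsRelator A ⁅freeF i, freeF j⁆

end Borcherds

/-- The Borcherds algebra `𝔤(A)` over `ℂ`. -/
abbrev BorcherdsAlgebra {I : Type u} (A : Matrix I I ℝ) : Type u :=
  FreeLieAlgebra ℂ (BorcherdsGenerator I) ⧸
    LieSubmodule.lieSpan ℂ (FreeLieAlgebra ℂ (BorcherdsGenerator I)) {x | BorcherdsRelator A x}

namespace BorcherdsAlgebra

variable {I : Type u} (A : Matrix I I ℝ)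

/-- The generator `e_i` of `𝔤(A)`. -/
def e (i : I) : BorcherdsAlgebra A :=
  LieSubmodule.Quotient.mk (freeE i)

/-- The generator `f_i` of `𝔤(A)`. -/
def f (i : I) : BorcherdsAlgebra A :=
  LieSubmodule.Quotient.mk (freeF i)

/-- The generator `h_i` of `𝔤(A)`. -/
def h (i : I) : BorcherdsAlgebra A :=
  LieSubmodule.Quotient.mk (freeH i)

end BorcherdsAlgebra

/-- The quotient of a Lie algebra by its center. -/
abbrev ModCenter (L : Type u) [LieRing L] [LieAlgebra ℂ L] : Type u := L ⧸ LieAlgebra.center ℂ L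

/-- The projection from a Lie algebra onto its quotient by the center. -/
def modCenterMap (L : Type u) [LieRing L] [LieAlgebra ℂ L] : L →ₗ⁅ℂ⁆ ModCenter L :=
  { (LieSubmodule.Quotient.mk' (LieAlgebra.center ℂ L) : L →ₗ[ℂ] ModCenter L) with
    map_lie' := fun {x y} => LieSubmodule.Quotient.mk_bracket (I := LieAlgebra.center ℂ L) x y }

/-- For `x : J → L` and a finitely supported exponent `l` whose support is `j₁ < ⋯ < jₙ`, the
element `ad(x j₁)^(l j₁) ⋯ ad(x jₙ)^(l jₙ) y`. -/
def orderedAd {L : Type u} [LieRing L] [LieAlgebra ℂ L] {J : Type v} (ord : LinearOrder J)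
    (x : J → L) (l : J →₀ ℕ) (y : L) : L :=
  letI := ord
  (l.support.sort (fun a b => a ≤ b)).foldr (fun j z => (LieAlgebra.ad ℂ L (x j) ^ l j) z) y

/-- The Lie subalgebra generated by the family `x` is free on that family. -/
def IsFreeFamily {L : Type u} [LieRing L] [LieAlgebra ℂ L] {X : Type v} (x : X → L) : Prop :=
  Function.Injective (FreeLieAlgebra.lift ℂ x)

/-- A Heisenberg Lie algebra: its derived algebra equals its center, which is one-dimensional. -/
structure IsHeisenberg (L : Type u) [LieRing L] [LieAlgebra ℂ L] : Prop where
  derived_eq_center : ⁅(⊤ : LieIdeal ℂ L), (⊤ : LieIdeal ℂ L)⁆ = LieAlgebra.center ℂ L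
  finrank_center : Module.finrank ℂ (LieAlgebra.center ℂ L) = 1

/-! ## The monstrous Lie algebra of a non-Fricke element -/

namespace Monstrous

/-- `I₋ = {(-m, j) : m > 0, 1 ≤ j ≤ c(m,0)}`. -/
def IMinus (c₀ : ℕ → ℕ) : Set (ℤ × ℤ) :=
  {p | ∃ m : ℕ, 0 < m ∧ p.1 = -(m : ℤ) ∧ 1 ≤ p.2 ∧ p.2 ≤ (c₀ m : ℤ)}

/-- `I₊ = {(n, k) : n > 0, 1 ≤ k ≤ c(1,n/N)}`. -/
def IPlus (c₁ : ℕ → ℕ) : Set (ℤ × ℤ) :=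
  {p | ∃ n : ℕ, 0 < n ∧ p.1 = (n : ℤ) ∧ 1 ≤ p.2 ∧ p.2 ≤ (c₁ n : ℤ)}

variable (c₀ c₁ : ℕ → ℕ)

/-- `I = I₋ ∪ I₊`. -/
abbrev Index : Type := ↥(IMinus c₀ ∪ IPlus c₁)

/-- The inclusion of `I₋` in `I`. -/
def ofMinus (j : IMinus c₀) : Index c₀ c₁ := ⟨j.1, Or.inl j.2⟩

/-- The inclusion of `I₊` in `I`. -/
def ofPlus (i : IPlus c₁) : Index c₀ c₁ := ⟨i.1, Or.inr i.2⟩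

/-- The matrix `A_g`: the entry at `(a, j), (b, k)` is `0` if `a, b < 0`, it is `a * b` if exactly
one of `a, b` is negative, and it is `-(a + b)` if `a, b > 0`. -/
def cartan : Matrix (Index c₀ c₁) (Index c₀ c₁) ℝ := fun p q =>
  if p.1.1 < 0 ∧ q.1.1 < 0 then 0
  else if p.1.1 < 0 ∨ q.1.1 < 0 then (p.1.1 : ℝ) * q.1.1
  else -((p.1.1 : ℝ) + q.1.1)

/-- The Borcherds algebra `𝔤(A_g)`. -/
abbrev Alg : Type := BorcherdsAlgebra (cartan c₀ c₁)

/-- The monstrous Lie algebra `𝔪_g = 𝔤(A_g)/𝔷`. -/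
abbrev MLie : Type := ModCenter (Alg c₀ c₁)

/-- The projection `𝔤(A_g) → 𝔪_g`. -/
def proj : Alg c₀ c₁ →ₗ⁅ℂ⁆ MLie c₀ c₁ := modCenterMap (Alg c₀ c₁)

/-- The family `U⁺` of the elements `ad(e_{j₁})^{l₁} ⋯ ad(e_{jₙ})^{lₙ} e_i` of `𝔤(A_g)`, with
`n ≥ 0`, `j₁ < ⋯ < jₙ` in `I₋`, all `l_k > 0`, and `i ∈ I₊`. -/
def UPlus (ord : LinearOrder (IMinus c₀)) (x : (IMinus c₀ →₀ ℕ) × IPlus c₁) : Alg c₀ c₁ :=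
  orderedAd ord (fun j => BorcherdsAlgebra.e (cartan c₀ c₁) (ofMinus c₀ c₁ j)) x.1
    (BorcherdsAlgebra.e (cartan c₀ c₁) (ofPlus c₀ c₁ x.2))

/-- The family `U⁻`, defined as `U⁺` with every `e` replaced by `f`. -/
def UMinus (ord : LinearOrder (IMinus c₀)) (x : (IMinus c₀ →₀ ℕ) × IPlus c₁) : Alg c₀ c₁ :=
  orderedAd ord (fun j => BorcherdsAlgebra.f (cartan c₀ c₁) (ofMinus c₀ c₁ j)) x.1
    (BorcherdsAlgebra.f (cartan c₀ c₁) (ofPlus c₀ c₁ x.2))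

/-- The Lie subalgebra `𝔲⁺` of `𝔤(A_g)` generated by `U⁺`. -/
def uPlus (ord : LinearOrder (IMinus c₀)) : LieSubalgebra ℂ (Alg c₀ c₁) :=
  LieSubalgebra.lieSpan ℂ (Alg c₀ c₁) (Set.range (UPlus c₀ c₁ ord))

/-- The Lie subalgebra `𝔲⁻` of `𝔤(A_g)` generated by `U⁻`. -/
def uMinus (ord : LinearOrder (IMinus c₀)) : LieSubalgebra ℂ (Alg c₀ c₁) :=
  LieSubalgebra.lieSpan ℂ (Alg c₀ c₁) (Set.range (UMinus c₀ c₁ ord))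

/-- The image of `e_i` in `𝔪_g`. -/
def eBar (i : Index c₀ c₁) : MLie c₀ c₁ := proj c₀ c₁ (BorcherdsAlgebra.e _ i)

/-- The image of `f_i` in `𝔪_g`. -/
def fBar (i : Index c₀ c₁) : MLie c₀ c₁ := proj c₀ c₁ (BorcherdsAlgebra.f _ i)

/-- The image of `h_i` in `𝔪_g`. -/
def hBar (i : Index c₀ c₁) : MLie c₀ c₁ := proj c₀ c₁ (BorcherdsAlgebra.h _ i)

end Monstrous

end

/-! The matrix `A_g` has no positive entries, so the Serre relations are void. The only relations
inside the span of brackets of the `f_i` come from zero entries, and these occur only between two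
indices of `I₋`. The negative part is thus generated by commuting elements `f_j`, `j ∈ I₋`, and by
elements `f_i`, `i ∈ I₊`, with no relation that involves the latter. Elimination
(`lieSpan_le_span_sup_lieSpan_orderedAd`) splits it into the abelian span of the `f_j` and the
algebra `𝔲⁻`; the involution `e ↔ f` gives the positive part.

Freeness (`isFreeFamily_f`) is detected by two actions. The algebra `𝔤(A)` acts on a Verma module
(`exists_verma`) realised on the associative algebra `NegAlg A`, with `f_i` acting by left
multiplication. In turn `NegAlg A` acts on `ℂ × L`, where `L` is the free Lie algebra on pairs
(exponent, index in `I₊`): an `f_j` with `j ∈ I₋` acts by the derivation that raises an exponent,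
and an `f_i` with `i ∈ I₊` by the adjoint action extended by the Euler cocycle. The composite
recovers a faithful representation of `L`, so no Lie polynomial in the displayed elements vanishes.

For the decomposition, the matrix has only two independent rows, and a dependence between rows makes
the same combination of the `h_i` central (`hBar_eq_of_row`). In `𝔪_g` every `h_i` therefore lies in
the span of `h_(-ℓ,1)` and `h_(1,1)`, and `[e_j, f_j]` is a nonzero multiple of `h_(-ℓ,1)` for `j ∈
I₋`: these are Heisenberg relations. The operator `ad h_(-ℓ,1)` has positive eigenvalues on `𝔲⁻`,
negative ones on `𝔲⁺`, and kills the middle part, so the sum is direct. Since no eigenvalue is zero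
on `𝔲^±`, these meet no central element.

That `I₋` is infinite is analytic (`infinite_exponents`): a finite product decays only polynomially
as `q → 1`, but the expansion at the other cusp forces exponential decay. -/

noncomputable section

attribute [local instance 100] LieRing.ofAssociativeRing

/-! ## Eigenvalues of derivations -/

section Eigen

variable {W : Type*} [AddCommGroup W] [Module ℂ W]

/-- The sum of the eigenspaces of `T` for eigenvalues in `S`. -/
def eigenSum (T : Module.End ℂ W) (S : Set ℂ) : Submodule ℂ W :=
  Submodule.span ℂ {x | ∃ μ ∈ S, T x = μ • x}

theorem mem_eigenSum {T : Module.End ℂ W} {S : Set ℂ} {x : W} {μ : ℂ} (hμ : μ ∈ S)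
    (h : T x = μ • x) : x ∈ eigenSum T S :=
  Submodule.subset_span ⟨μ, hμ, h⟩

theorem eigenSum_le_iSup (T : Module.End ℂ W) (S : Set ℂ) :
    eigenSum T S ≤ ⨆ μ ∈ S, T.eigenspace μ := by
  refine Submodule.span_le.2 ?_
  rintro x ⟨μ, hμ, h⟩
  exact Submodule.mem_iSup_of_mem μ (Submodule.mem_iSup_of_mem hμ (Module.End.mem_eigenspace_iff.2 h))

/-- Eigenspaces for distinct eigenvalues are independent. All later injectivity and directness
statements reduce to this separation. -/
theorem disjoint_eigenSum (T : Module.End ℂ W) {S S' : Set ℂ} (h : Disjoint S S') :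
    Disjoint (eigenSum T S) (eigenSum T S') :=
  ((T.eigenspaces_iSupIndep).disjoint_biSup_biSup h).mono (eigenSum_le_iSup T S)
    (eigenSum_le_iSup T S')

theorem eq_zero_of_mem_eigenSum {T : Module.End ℂ W} {S : Set ℂ} (h0 : (0 : ℂ) ∉ S) {x : W}
    (hx : x ∈ eigenSum T S) (hT : T x = 0) : x = 0 :=
  Submodule.disjoint_def.1 (disjoint_eigenSum T (Set.disjoint_singleton_right.2 h0)) x hx
    (mem_eigenSum (Set.mem_singleton 0) (by simpa using hT))

variable {L : Type*} [LieRing L] [LieAlgebra ℂ L]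

/-- The Lie subalgebra spanned by the eigenvectors of a derivation, for a set of eigenvalues that is
closed under addition. -/
def eigenSubalgebra (T : Module.End ℂ L) (hT : ∀ x y, T ⁅x, y⁆ = ⁅T x, y⁆ + ⁅x, T y⁆)
    (S : Set ℂ) (hS : ∀ a ∈ S, ∀ b ∈ S, a + b ∈ S) : LieSubalgebra ℂ L where
  toSubmodule := eigenSum T S
  lie_mem' := by
    intro x y hx hy
    induction hx, hy using Submodule.span_induction₂ with
    | mem_mem x y hx hy =>
      obtain ⟨a, ha, hx⟩ := hx
      obtain ⟨b, hb, hy⟩ := hy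
      exact mem_eigenSum (hS a ha b hb) (by rw [hT, hx, hy, smul_lie, lie_smul, add_smul])
    | zero_left y hy => simp
    | zero_right x hx => simp
    | add_left x y z hx hy hz h1 h2 => rw [add_lie]; exact Submodule.add_mem _ h1 h2
    | add_right x y z hx hy hz h1 h2 => rw [lie_add]; exact Submodule.add_mem _ h1 h2
    | smul_left r x y hx hy h => rw [smul_lie]; exact Submodule.smul_mem _ _ h
    | smul_right r x y hx hy h => rw [lie_smul]; exact Submodule.smul_mem _ _ h

theorem lieSpan_le_eigenSum {T : Module.End ℂ L} (hT : ∀ x y, T ⁅x, y⁆ = ⁅T x, y⁆ + ⁅x, T y⁆)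
    {S : Set ℂ} (hS : ∀ a ∈ S, ∀ b ∈ S, a + b ∈ S) {s : Set L}
    (hs : ∀ x ∈ s, ∃ μ ∈ S, T x = μ • x) :
    (LieSubalgebra.lieSpan ℂ L s).toSubmodule ≤ eigenSum T S := by
  have : LieSubalgebra.lieSpan ℂ L s ≤ eigenSubalgebra T hT S hS :=
    LieSubalgebra.lieSpan_le.2 fun x hx => Submodule.subset_span (hs x hx)
  exact this

end Eigen

/-! ## The free Lie algebra -/

namespace FreeLieAlgebra

variable {X : Type*}

/-- The universal property gives a map into the subalgebra generated by the letters; followed by the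
inclusion it fixes every letter, hence is the identity, so every element lies in the subalgebra. -/
theorem lieSpan_range_of :
    LieSubalgebra.lieSpan ℂ (FreeLieAlgebra ℂ X) (Set.range (of ℂ)) = ⊤ := by
  set S := LieSubalgebra.lieSpan ℂ (FreeLieAlgebra ℂ X) (Set.range (of ℂ)) with hS
  let φ : FreeLieAlgebra ℂ X →ₗ⁅ℂ⁆ S :=
    lift ℂ fun x => (⟨of ℂ x, LieSubalgebra.subset_lieSpan ⟨x, rfl⟩⟩ : S)
  have h : S.incl.comp φ = LieHom.id := by
    ext x
    simp [φ]
  refine eq_top_iff.2 fun y _ => ?_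
  have := LieHom.congr_fun h y
  simp only [LieHom.comp_apply, LieHom.id_apply] at this
  rw [← this]
  exact (φ y).2

/-- The representation of the free Lie algebra `L` on `ℂ × L` whose cocycle extends `D₀`. -/
def derRep (D₀ : X → FreeLieAlgebra ℂ X) :
    FreeLieAlgebra ℂ X →ₗ⁅ℂ⁆ Module.End ℂ (ℂ × FreeLieAlgebra ℂ X) :=
  lift ℂ fun x => LinearMap.inr ℂ ℂ _ ∘ₗ (LinearMap.coprod (LinearMap.toSpanSingleton ℂ _ (D₀ x))
    (LieAlgebra.ad ℂ (FreeLieAlgebra ℂ X) (of ℂ x)))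

/-- The derivation of the free Lie algebra that extends `D₀`. -/
def der (D₀ : X → FreeLieAlgebra ℂ X) : Module.End ℂ (FreeLieAlgebra ℂ X) where
  toFun y := (derRep D₀ y (1, 0)).2
  map_add' x y := by simp
  map_smul' r x := by simp

/-- The operators have the form of an extension of the adjoint representation by a cocycle `y ↦ der
D₀ y`. Compatibility with brackets is exactly the Leibniz rule for that cocycle, so the universal
property produces the derivation. -/
theorem derRep_apply (D₀ : X → FreeLieAlgebra ℂ X) (y : FreeLieAlgebra ℂ X)
    (p : ℂ × FreeLieAlgebra ℂ X) : derRep D₀ y p = (0, p.1 • der D₀ y + ⁅y, p.2⁆) := by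
  have hy : y ∈ LieSubalgebra.lieSpan ℂ (FreeLieAlgebra ℂ X) (Set.range (of ℂ)) := by
    rw [lieSpan_range_of]; trivial
  induction hy using LieSubalgebra.lieSpan_induction generalizing p with
  | mem x hx =>
    obtain ⟨x, rfl⟩ := hx
    simp [der, derRep]
  | zero => ext <;> simp
  | add x y _ _ hx hy => rw [map_add, LinearMap.add_apply, hx, hy]; ext <;> simp; abel
  | smul a x _ hx =>
    rw [map_smul, LinearMap.smul_apply, hx]; ext <;> simp [smul_comm a]
  | lie x y _ _ hx hy =>
    -- Evaluation of the commutator of the two operators at `(1, 0)` yields the cocycle identity.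
    have key : der D₀ ⁅x, y⁆ = ⁅x, der D₀ y⁆ - ⁅y, der D₀ x⁆ := by
      change (derRep D₀ ⁅x, y⁆ (1, 0)).2 = _
      rw [LieHom.map_lie, LieRing.of_associative_ring_bracket, LinearMap.sub_apply,
        Module.End.mul_apply, Module.End.mul_apply, hy, hx, hy, hx]
      simp
    rw [LieHom.map_lie, LieRing.of_associative_ring_bracket, LinearMap.sub_apply,
      Module.End.mul_apply, Module.End.mul_apply, hy, hx, hy, hx, key, lie_lie]
    refine Prod.ext (by simp) ?_
    simp only [Prod.snd_sub, zero_smul, zero_add, lie_add, lie_smul, smul_sub]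
    abel

theorem der_lie (D₀ : X → FreeLieAlgebra ℂ X) (x y : FreeLieAlgebra ℂ X) :
    der D₀ ⁅x, y⁆ = ⁅der D₀ x, y⁆ + ⁅x, der D₀ y⁆ := by
  change (derRep D₀ ⁅x, y⁆ (1, 0)).2 = _
  rw [LieHom.map_lie, LieRing.of_associative_ring_bracket, LinearMap.sub_apply,
    Module.End.mul_apply, Module.End.mul_apply]
  simp only [derRep_apply, Prod.snd_sub, zero_smul, one_smul, zero_add, lie_zero, add_zero]
  rw [← lie_skew (der D₀ x) y]
  abel

@[simp]
theorem der_of (D₀ : X → FreeLieAlgebra ℂ X) (x : X) : der D₀ (of ℂ x) = D₀ x := by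
  simp [der, derRep]

/-- A derivation that vanishes on the generators is zero. -/
theorem der_ext {T : Module.End ℂ (FreeLieAlgebra ℂ X)}
    (hT : ∀ x y, T ⁅x, y⁆ = ⁅T x, y⁆ + ⁅x, T y⁆) (h : ∀ x, T (of ℂ x) = 0) : T = 0 := by
  ext y
  have hy : y ∈ LieSubalgebra.lieSpan ℂ (FreeLieAlgebra ℂ X) (Set.range (of ℂ)) := by
    rw [lieSpan_range_of]; trivial
  induction hy using LieSubalgebra.lieSpan_induction with
  | mem x hx => obtain ⟨x, rfl⟩ := hx; simpa using h x
  | zero => simp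
  | add x y _ _ hx hy => rw [map_add, hx, hy]; simp
  | smul a x _ hx => rw [map_smul, hx]; simp
  | lie x y _ _ hx hy => rw [hT, hx, hy]; simp

/-- The Euler derivation, which multiplies by the degree. -/
abbrev euler : Module.End ℂ (FreeLieAlgebra ℂ X) := der (of ℂ)

/-- The letters have eigenvalue `1` and eigenvalues add under brackets, so the free Lie algebra is
spanned by eigenvectors with eigenvalues `n + 1`, none of which is zero. -/
theorem euler_injective {y : FreeLieAlgebra ℂ X} (h : euler y = 0) : y = 0 := by
  let S : Set ℂ := {μ | ∃ n : ℕ, μ = n + 1}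
  refine eq_zero_of_mem_eigenSum (T := euler) (S := S) ?_ ?_ h
  · rintro ⟨n, hn⟩
    exact n.cast_add_one_ne_zero hn.symm
  · refine lieSpan_le_eigenSum (der_lie _) (S := S) ?_ (s := Set.range (of ℂ)) ?_ ?_
    · rintro _ ⟨m, rfl⟩ _ ⟨n, rfl⟩
      exact ⟨m + n + 1, by push_cast; ring⟩
    · rintro _ ⟨x, rfl⟩
      exact ⟨1, ⟨0, by simp⟩, by simp⟩
    · rw [lieSpan_range_of]; trivial

end FreeLieAlgebra

/-! ## Ordered products of `ad` -/

section OrderedAd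

variable {L : Type*} [LieRing L] [LieAlgebra ℂ L] {J : Type*} (ord : LinearOrder J)

theorem LieHom.map_orderedAd {L' : Type*} [LieRing L'] [LieAlgebra ℂ L'] (φ : L →ₗ⁅ℂ⁆ L')
    (x : J → L) (l : J →₀ ℕ) (y : L) :
    φ (orderedAd ord x l y) = orderedAd ord (fun j => φ (x j)) l (φ y) := by
  unfold orderedAd
  simp only
  induction (@Finset.sort J l.support (fun a b => a ≤ b) _ _ _ _ : List J) with
  | nil => rfl
  | cons j t ih =>
    simp only [List.foldr_cons]
    rw [← ih]
    generalize List.foldr _ _ t = z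
    induction l j with
    | zero => simp
    | succ n hn => rw [pow_succ', Module.End.mul_apply, pow_succ', Module.End.mul_apply,
        LieAlgebra.ad_apply, LieAlgebra.ad_apply, LieHom.map_lie, hn]

/-- If every `ad (x j)` shifts the exponent of a family, then the ordered products of the `ad (x j)`
generate the family from its member with exponent zero. -/
theorem orderedAd_eq_of_shift {x : J → L} {y : (J →₀ ℕ) → L}
    (h : ∀ j l, ⁅x j, y l⁆ = y (l + Finsupp.single j 1)) (l : J →₀ ℕ) :
    orderedAd ord x l (y 0) = y l := by
  unfold orderedAd
  have hpow : ∀ j n l, (LieAlgebra.ad ℂ L (x j) ^ n) (y l) = y (l + Finsupp.single j n) := by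
    intro j n l
    induction n with
    | zero => simp
    | succ n ih =>
      rw [pow_succ', Module.End.mul_apply, ih, LieAlgebra.ad_apply, h, add_assoc,
        ← Finsupp.single_add]
  have key : ∀ t : List J, t.foldr (fun j z => (LieAlgebra.ad ℂ L (x j) ^ l j) z) (y 0) =
      y (t.map fun j => Finsupp.single j (l j)).sum := by
    intro t
    induction t with
    | nil => simp
    | cons j t ih =>
      rw [List.foldr_cons, ih, hpow, List.map_cons, List.sum_cons, add_comm]
  rw [key]
  congr 1
  rw [← List.sum_toFinset _ (Finset.sort_nodup _ _), Finset.sort_toFinset]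
  exact l.sum_single

end OrderedAd

/-! ## Borcherds algebras without real simple roots -/

namespace BorcherdsAlgebra

variable {I : Type*} (A : Matrix I I ℝ)

/-- The projection from the free Lie algebra. -/
def mkHom : FreeLieAlgebra ℂ (BorcherdsGenerator I) →ₗ⁅ℂ⁆ BorcherdsAlgebra A :=
  { (LieSubmodule.Quotient.mk' (LieSubmodule.lieSpan ℂ (FreeLieAlgebra ℂ (BorcherdsGenerator I))
      {x | BorcherdsRelator A x}) :
      FreeLieAlgebra ℂ (BorcherdsGenerator I) →ₗ[ℂ] BorcherdsAlgebra A) with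
    map_lie' := fun {x y} => LieSubmodule.Quotient.mk_bracket (I := LieSubmodule.lieSpan ℂ
      (FreeLieAlgebra ℂ (BorcherdsGenerator I)) {x | BorcherdsRelator A x}) x y }

theorem mkHom_surjective : Function.Surjective (mkHom A) :=
  LieSubmodule.Quotient.surjective_mk' _

variable {A} in
theorem mkHom_relator {x : FreeLieAlgebra ℂ (BorcherdsGenerator I)} (hx : BorcherdsRelator A x) :
    mkHom A x = 0 :=
  (LieSubmodule.Quotient.mk_eq_zero (N := LieSubmodule.lieSpan ℂ
    (FreeLieAlgebra ℂ (BorcherdsGenerator I)) {x | BorcherdsRelator A x})).2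
    (LieSubmodule.subset_lieSpan hx)

theorem h_lie_h (i j : I) : ⁅h A i, h A j⁆ = 0 := mkHom_relator (.h_h i j)

theorem h_lie_e (i j : I) : ⁅h A i, e A j⁆ = (A i j : ℂ) • e A j :=
  sub_eq_zero.1 (mkHom_relator (.h_e i j))

theorem h_lie_f (i j : I) : ⁅h A i, f A j⁆ = -((A i j : ℂ) • f A j) :=
  eq_neg_of_add_eq_zero_left (mkHom_relator (.h_f i j))

theorem e_lie_f_same (i : I) : ⁅e A i, f A i⁆ = h A i :=
  sub_eq_zero.1 (mkHom_relator (.e_f_same i))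

theorem e_lie_f_ne {i j : I} (hij : i ≠ j) : ⁅e A i, f A j⁆ = 0 :=
  mkHom_relator (.e_f_ne i j hij)

variable {A} in
theorem e_lie_e {i j : I} (hij : A i j = 0) : ⁅e A i, e A j⁆ = 0 :=
  mkHom_relator (.orthogonal_e i j hij)

variable {A} in
theorem f_lie_f {i j : I} (hij : A i j = 0) : ⁅f A i, f A j⁆ = 0 :=
  mkHom_relator (.orthogonal_f i j hij)

/-- The generators `e i`, `f i`, `h i`. -/
def gen : BorcherdsGenerator I → BorcherdsAlgebra A
  | .e i => e A i
  | .f i => f A i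
  | .h i => h A i

theorem lieSpan_gen : LieSubalgebra.lieSpan ℂ (BorcherdsAlgebra A) (Set.range (gen A)) = ⊤ := by
  have h1 : (mkHom A).range = ⊤ := (LieHom.range_eq_top _).2 (mkHom_surjective A)
  rw [← h1, LieHom.range_eq_map, ← FreeLieAlgebra.lieSpan_range_of, LieSubalgebra.map_lieSpan,
    ← Set.range_comp]
  congr 2
  funext x
  cases x <;> rfl

/-- A subspace that contains the generators and is stable under them is everything. -/
theorem eq_top_of_stable {W : Submodule ℂ (BorcherdsAlgebra A)} (h1 : ∀ s, gen A s ∈ W)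
    (h2 : ∀ s, ∀ w ∈ W, ⁅gen A s, w⁆ ∈ W) : W = ⊤ := by
  -- The elements whose `ad` preserves `W` form a subalgebra, so it suffices to have the generators
  -- among them.
  have stable : ∀ x : BorcherdsAlgebra A, ∀ w ∈ W, ⁅x, w⁆ ∈ W := by
    intro x
    have hx : x ∈ LieSubalgebra.lieSpan ℂ (BorcherdsAlgebra A) (Set.range (gen A)) := by
      rw [lieSpan_gen]; trivial
    induction hx using LieSubalgebra.lieSpan_induction with
    | mem x hx => obtain ⟨s, rfl⟩ := hx; exact h2 s
    | zero => intro w _; simp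
    | add x y _ _ hx hy => intro w hw; rw [add_lie]; exact W.add_mem (hx w hw) (hy w hw)
    | smul a x _ hx => intro w hw; rw [smul_lie]; exact W.smul_mem _ (hx w hw)
    | lie x y _ _ hx hy =>
      intro w hw
      rw [lie_lie]
      exact W.sub_mem (hx _ (hy w hw)) (hy _ (hx w hw))
  refine eq_top_iff.2 fun x _ => ?_
  have hx : x ∈ LieSubalgebra.lieSpan ℂ (BorcherdsAlgebra A) (Set.range (gen A)) := by
    rw [lieSpan_gen]; trivial
  induction hx using LieSubalgebra.lieSpan_induction with
  | mem x hx => obtain ⟨s, rfl⟩ := hx; exact h1 s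
  | zero => exact W.zero_mem
  | add x y _ _ hx hy => exact W.add_mem (hx trivial) (hy trivial)
  | smul a x _ hx => exact W.smul_mem _ (hx trivial)
  | lie x y _ _ hx hy => exact stable x y (hy trivial)

theorem mem_center_of_gen {x : BorcherdsAlgebra A} (h : ∀ s, ⁅gen A s, x⁆ = 0) :
    x ∈ LieAlgebra.center ℂ (BorcherdsAlgebra A) := by
  rw [LieModule.mem_maxTrivSubmodule]
  intro y
  have hy : y ∈ LieSubalgebra.lieSpan ℂ (BorcherdsAlgebra A) (Set.range (gen A)) := by
    rw [lieSpan_gen]; trivial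
  induction hy using LieSubalgebra.lieSpan_induction with
  | mem y hy => obtain ⟨s, rfl⟩ := hy; exact h s
  | zero => simp
  | add y z _ _ hy hz => rw [add_lie, hy, hz, add_zero]
  | smul a y _ hy => rw [smul_lie, hy, smul_zero]
  | lie y z _ _ hy hz => rw [lie_lie, hy, hz]; simp

/-- The Lie homomorphism out of `𝔤(A)` defined by a map that kills the relators. -/
def lift {L : Type*} [LieRing L] [LieAlgebra ℂ L]
    (φ : FreeLieAlgebra ℂ (BorcherdsGenerator I) →ₗ⁅ℂ⁆ L)
    (hφ : ∀ x, BorcherdsRelator A x → φ x = 0) : BorcherdsAlgebra A →ₗ⁅ℂ⁆ L :=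
  { Submodule.liftQ (LieSubmodule.lieSpan ℂ (FreeLieAlgebra ℂ (BorcherdsGenerator I))
      {x | BorcherdsRelator A x}).toSubmodule (φ : _ →ₗ[ℂ] L) (by
        have : LieSubmodule.lieSpan ℂ (FreeLieAlgebra ℂ (BorcherdsGenerator I))
            {x | BorcherdsRelator A x} ≤ φ.ker :=
          LieSubmodule.lieSpan_le.2 fun x hx => LieHom.mem_ker.2 (hφ x hx)
        exact fun x hx => LieHom.mem_ker.1 (this hx)) with
    map_lie' := by
      intro x y
      obtain ⟨x, rfl⟩ := mkHom_surjective A x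
      obtain ⟨y, rfl⟩ := mkHom_surjective A y
      exact φ.map_lie x y }

/-- A Lie homomorphism out of `𝔤(A)` from images of the generators, if `A` has no positive diagonal
entries. -/
theorem exists_hom {L : Type*} [LieRing L] [LieAlgebra ℂ L] (hA : ∀ i, A i i ≤ 0)
    (E F H : I → L) (hh : ∀ i j, ⁅H i, H j⁆ = 0) (he : ∀ i j, ⁅H i, E j⁆ = (A i j : ℂ) • E j)
    (hf : ∀ i j, ⁅H i, F j⁆ = -((A i j : ℂ) • F j)) (hef : ∀ i, ⁅E i, F i⁆ = H i)
    (hne : ∀ i j, i ≠ j → ⁅E i, F j⁆ = 0) (hee : ∀ i j, A i j = 0 → ⁅E i, E j⁆ = 0)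
    (hff : ∀ i j, A i j = 0 → ⁅F i, F j⁆ = 0) :
    ∃ φ : BorcherdsAlgebra A →ₗ⁅ℂ⁆ L, ∀ i, φ (e A i) = E i ∧ φ (f A i) = F i ∧ φ (h A i) = H i := by
  let φ : FreeLieAlgebra ℂ (BorcherdsGenerator I) →ₗ⁅ℂ⁆ L := FreeLieAlgebra.lift ℂ fun
    | .e i => E i
    | .f i => F i
    | .h i => H i
  have φe : ∀ i, φ (freeE i) = E i := fun i => FreeLieAlgebra.lift_of_apply _ _
  have φf : ∀ i, φ (freeF i) = F i := fun i => FreeLieAlgebra.lift_of_apply _ _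
  have φh : ∀ i, φ (freeH i) = H i := fun i => FreeLieAlgebra.lift_of_apply _ _
  refine ⟨lift A φ ?_, fun i => ⟨φe i, φf i, φh i⟩⟩
  intro x hx
  cases hx with
  | h_h i j => rw [LieHom.map_lie, φh, φh, hh]
  | h_e i j => rw [map_sub, LieHom.map_lie, map_smul, φh, φe, he, sub_self]
  | h_f i j => rw [map_add, LieHom.map_lie, map_smul, φh, φf, hf, neg_add_cancel]
  | e_f_same i => rw [map_sub, LieHom.map_lie, φh, φe, φf, hef, sub_self]
  | e_f_ne i j hij => rw [LieHom.map_lie, φe, φf, hne i j hij]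
  -- A Serre relator requires a positive diagonal entry, which `hA` excludes.
  | serre_e i j k _ hi _ => exact absurd hi (not_lt.2 (hA i))
  | serre_f i j k _ hi _ => exact absurd hi (not_lt.2 (hA i))
  | orthogonal_e i j hij => rw [LieHom.map_lie, φe, φe, hee i j hij]
  | orthogonal_f i j hij => rw [LieHom.map_lie, φf, φf, hff i j hij]

/-- The involution that exchanges `e i` and `f i`. -/
theorem exists_involution (hA : ∀ i, A i i ≤ 0) :
    ∃ ω : BorcherdsAlgebra A →ₗ⁅ℂ⁆ BorcherdsAlgebra A,
      ∀ i, ω (e A i) = f A i ∧ ω (f A i) = e A i ∧ ω (h A i) = -h A i :=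
  exists_hom A hA _ _ _ (fun i j => by simp [h_lie_h]) (fun i j => by simp [h_lie_f])
    (fun i j => by simp [h_lie_e]) (fun i => by rw [← lie_skew, e_lie_f_same])
    (fun i j hij => by rw [← lie_skew, e_lie_f_ne A hij.symm, neg_zero])
    (fun i j => f_lie_f) (fun i j => e_lie_e)

/-! ### The enveloping algebra of the negative part and the Verma module -/

/-- The relations `f_i f_j = f_j f_i`, for `a_ij = 0`. -/
inductive CommRel : FreeAlgebra ℂ I → FreeAlgebra ℂ I → Prop
  | comm (i j : I) : A i j = 0 →
      CommRel (FreeAlgebra.ι ℂ i * FreeAlgebra.ι ℂ j) (FreeAlgebra.ι ℂ j * FreeAlgebra.ι ℂ i)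

/-- The associative algebra generated by the `f_i`, with `f_i f_j = f_j f_i` for `a_ij = 0`. -/
abbrev NegAlg : Type _ := RingQuot (CommRel A)

namespace NegAlg

/-- The generators of `NegAlg A`. -/
def x (i : I) : NegAlg A := RingQuot.mkAlgHom ℂ (CommRel A) (FreeAlgebra.ι ℂ i)

variable {A}

theorem x_comm {i j : I} (hij : A i j = 0) : x A i * x A j = x A j * x A i := by
  unfold x
  rw [← map_mul, ← map_mul]
  exact RingQuot.mkAlgHom_rel ℂ (CommRel.comm i j hij)

theorem exists_lift {B : Type*} [Ring B] [Algebra ℂ B] (y : I → B)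
    (hy : ∀ i j, A i j = 0 → y i * y j = y j * y i) :
    ∃ ψ : NegAlg A →ₐ[ℂ] B, ∀ i, ψ (x A i) = y i := by
  refine ⟨RingQuot.liftAlgHom ℂ ⟨FreeAlgebra.lift ℂ y, ?_⟩, fun i => ?_⟩
  · rintro _ _ ⟨i, j, hij⟩
    simp [hy i j hij]
  · simp [x]

/-- Induction along left multiplication by the generators, starting from `1`. It verifies operator
identities on the Verma module, where operators are known only through such recursions. -/
theorem linearMap_eq_zero {W : Type*} [AddCommGroup W] [Module ℂ W] (T : NegAlg A →ₗ[ℂ] W)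
    (h1 : T 1 = 0) (h2 : ∀ i a, T a = 0 → T (x A i * a) = 0) : T = 0 := by
  have key : ∀ b : FreeAlgebra ℂ I, ∀ a, T a = 0 →
      T (RingQuot.mkAlgHom ℂ (CommRel A) b * a) = 0 := by
    intro b
    induction b using FreeAlgebra.induction with
    | grade0 r => intro a ha; rw [AlgHom.commutes, ← Algebra.smul_def, map_smul, ha, smul_zero]
    | grade1 i => exact h2 i
    | mul b c hb hc => intro a ha; rw [map_mul (RingQuot.mkAlgHom ℂ (CommRel A)), mul_assoc]; exact hb _ (hc a ha)
    | add b c hb hc => intro a ha; rw [map_add, add_mul, map_add, hb a ha, hc a ha, add_zero]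
  ext a
  obtain ⟨b, rfl⟩ := RingQuot.mkAlgHom_surjective ℂ (CommRel A) a
  simpa using key b 1 h1

/-- An operator prescribed by a recursion on monomials is well defined as soon as the recursion
respects `x_i x_j = x_j x_i`, which is the condition `hG`. The pair `(a, D a)` is obtained by
letting `NegAlg A` act on pairs: the first component records the monomial, the second the value of
the operator. -/
theorem exists_skew (G : I → Module.End ℂ (NegAlg A)) (m : NegAlg A)
    (hG : ∀ i j, A i j = 0 → ∀ a, x A i * G j a + G i (x A j * a) =
      x A j * G i a + G j (x A i * a)) :
    ∃ D : Module.End ℂ (NegAlg A), D 1 = m ∧ ∀ i a, D (x A i * a) = x A i * D a + G i a := by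
  let y : I → Module.End ℂ (NegAlg A × NegAlg A) := fun i =>
    LinearMap.prod (LinearMap.mulLeft ℂ (x A i) ∘ₗ LinearMap.fst ℂ _ _)
      (LinearMap.mulLeft ℂ (x A i) ∘ₗ LinearMap.snd ℂ _ _ + G i ∘ₗ LinearMap.fst ℂ _ _)
  have hy : ∀ i p, y i p = (x A i * p.1, x A i * p.2 + G i p.1) := fun i p => rfl
  obtain ⟨ψ, hψ⟩ := exists_lift (A := A) y (by
    intro i j hij
    refine LinearMap.ext fun p => ?_
    rw [Module.End.mul_apply, Module.End.mul_apply, hy, hy, hy, hy]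
    refine Prod.ext ?_ ?_
    · simp only [← mul_assoc, x_comm hij]
    · simp only [mul_add, ← mul_assoc, x_comm hij, add_assoc, hG i j hij])
  let ev : NegAlg A →ₗ[ℂ] NegAlg A × NegAlg A :=
    LinearMap.applyₗ ((1, m) : NegAlg A × NegAlg A) ∘ₗ ψ.toLinearMap
  have hev : ∀ a, ev a = ψ a (1, m) := fun a => rfl
  have hx : ∀ i a, ev (x A i * a) = y i (ev a) := by
    intro i a
    rw [hev, hev, map_mul, hψ, Module.End.mul_apply]
  have h1 : ∀ a, (ev a).1 = a := by
    have : LinearMap.fst ℂ _ _ ∘ₗ ev - LinearMap.id = 0 := by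
      refine linearMap_eq_zero _ ?_ ?_
      · simp [hev]
      · intro i a ha
        have ha' : (ev a).1 = a := by simpa [sub_eq_zero] using ha
        simp [hx, hy, ha']
    intro a
    simpa [sub_eq_zero] using LinearMap.congr_fun this a
  refine ⟨LinearMap.snd ℂ _ _ ∘ₗ ev, by simp [hev], fun i a => ?_⟩
  simp [hx, hy, h1]

end NegAlg

open NegAlg in
/-- The Verma module of highest weight `h_i ↦ 1`. -/
theorem exists_verma (hA : ∀ i, A i i ≤ 0) (hs : ∀ i j, A i j = A j i) :
    ∃ ρ : BorcherdsAlgebra A →ₗ⁅ℂ⁆ Module.End ℂ (NegAlg A),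
      ∀ i, ρ (f A i) = LinearMap.mulLeft ℂ (x A i) ∧ ρ (h A i) 1 = 1 := by
  classical
  -- The recursion says that `x_k` lowers the `h_i`-weight by `a_ik`; the value `1` at the vacuum
  -- makes each `h_i` visibly nonzero.
  have hH : ∀ i, ∃ D : Module.End ℂ (NegAlg A), D 1 = 1 ∧
      ∀ k a, D (x A k * a) = x A k * D a - (A i k : ℂ) • (x A k * a) := by
    intro i
    obtain ⟨D, h1, h2⟩ := exists_skew (A := A)
      (fun k => -(A i k : ℂ) • LinearMap.mulLeft ℂ (x A k)) 1 (by
        intro k l hkl a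
        simp only [LinearMap.smul_apply, LinearMap.mulLeft_apply, mul_smul_comm, ← mul_assoc,
          x_comm hkl]
        abel)
    exact ⟨D, h1, fun k a => by rw [h2]; simp [sub_eq_add_neg, -Complex.coe_smul]⟩
  choose H H1 Hx using hH
  -- This is `[e_i, f_k] = δ_ik h_i` with `e_i` killing the highest weight vector. Consistency with
  -- a relation between `x_i` and `x_l` needs `a_il = 0`, so that `H i` commutes with `x_l`.
  have hE : ∀ i, ∃ D : Module.End ℂ (NegAlg A), D 1 = 0 ∧
      ∀ k a, D (x A k * a) = x A k * D a + if i = k then H i a else 0 := by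
    intro i
    obtain ⟨D, h1, h2⟩ := exists_skew (A := A) (fun k => if i = k then H i else 0) 0 (by
      intro k l hkl a
      by_cases hk : i = k <;> by_cases hl : i = l
      · subst hk; subst hl; simp
      · subst hk; simp [hl, Hx, hkl]
      · subst hl; simp [hk, Hx, hs i k, hkl]
      · simp [hk, hl])
    exact ⟨D, h1, fun k a => by rw [h2]; by_cases hk : i = k <;> simp [hk]⟩
  choose E E1 Ex using hE
  have hHH : ∀ i j a, H i (H j a) = H j (H i a) := by
    intro i j
    have : H i * H j - H j * H i = 0 := by
      refine linearMap_eq_zero _ (by simp [H1]) fun k a ha => ?_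
      simp only [LinearMap.sub_apply, Module.End.mul_apply, Hx, map_sub, map_smul] at ha ⊢
      rw [sub_eq_zero] at ha
      rw [ha]
      module
    exact fun a => sub_eq_zero.1 (LinearMap.congr_fun this a)
  have hHE : ∀ i j a, H i (E j a) = E j (H i a) + (A i j : ℂ) • E j a := by
    intro i j
    have : H i * E j - E j * H i - (A i j : ℂ) • E j = 0 := by
      refine linearMap_eq_zero _ (by simp [H1, E1, -Complex.coe_smul]) fun k a ha => ?_
      simp only [LinearMap.sub_apply, LinearMap.smul_apply, Module.End.mul_apply, Hx, Ex, map_sub,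
        map_add, map_smul] at ha ⊢
      rw [sub_sub, sub_eq_zero] at ha
      rw [ha, mul_add, mul_smul_comm]
      by_cases hk : j = k
      · subst hk
        simp only [if_true, hHH i j]
        module
      · simp only [hk, if_false, map_zero]
        module
    intro a
    have := LinearMap.congr_fun this a
    simp only [LinearMap.sub_apply, Module.End.mul_apply, LinearMap.zero_apply, sub_sub] at this
    exact sub_eq_zero.1 this
  have hEE : ∀ i j, A i j = 0 → ⁅E i, E j⁆ = 0 := by
    intro i j hij
    have hji : A j i = 0 := hs i j ▸ hij
    have h1 : ∀ a, H i (E j a) = E j (H i a) := fun a => by simp [hHE, hij]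
    have h2 : ∀ a, H j (E i a) = E i (H j a) := fun a => by simp [hHE, hji]
    rw [LieRing.of_associative_ring_bracket]
    refine linearMap_eq_zero _ (by simp [E1]) fun k a ha => ?_
    simp only [LinearMap.sub_apply, Module.End.mul_apply, Ex, map_add] at ha ⊢
    rw [sub_eq_zero] at ha
    rw [ha]
    by_cases hi : i = k <;> by_cases hj : j = k <;> simp [hi, hj]
    · subst hi; rw [h1, sub_self]
    · subst hj; rw [h2, sub_self]
  obtain ⟨ρ, hρ⟩ := exists_hom A hA E (fun i => LinearMap.mulLeft ℂ (x A i)) H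
    (fun i j => by
      rw [LieRing.of_associative_ring_bracket, sub_eq_zero]
      exact LinearMap.ext (hHH i j))
    (fun i j => by
      rw [LieRing.of_associative_ring_bracket, sub_eq_iff_eq_add']
      exact LinearMap.ext (hHE i j))
    (fun i j => by
      refine LinearMap.ext fun a => ?_
      simp only [LieRing.of_associative_ring_bracket, LinearMap.sub_apply, Module.End.mul_apply,
        LinearMap.mulLeft_apply, Hx, LinearMap.neg_apply, LinearMap.smul_apply]
      abel)
    (fun i => by
      refine LinearMap.ext fun a => ?_
      simp [LieRing.of_associative_ring_bracket, Ex])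
    (fun i j hij => by
      refine LinearMap.ext fun a => ?_
      simp [LieRing.of_associative_ring_bracket, Ex, hij])
    hEE
    (fun i j hij => by
      refine LinearMap.ext fun a => ?_
      simp [LieRing.of_associative_ring_bracket, ← mul_assoc, x_comm hij])
  exact ⟨ρ, fun i => ⟨(hρ i).2.1, by rw [(hρ i).2.2, H1]⟩⟩

end BorcherdsAlgebra

/-! ### Freeness of the subalgebras generated by the ordered products -/

namespace FreeLieAlgebra

/-- The commutator of two derivations is a derivation, hence determined by its values on the
letters. -/
theorem der_comm {X : Type*} {D D' : X → FreeLieAlgebra ℂ X}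
    (h : ∀ x, der D (D' x) = der D' (D x)) (y : FreeLieAlgebra ℂ X) :
    der D (der D' y) = der D' (der D y) := by
  have : der D * der D' - der D' * der D = 0 := by
    refine der_ext (fun x y => ?_) fun x => ?_
    · simp only [LinearMap.sub_apply, Module.End.mul_apply, der_lie, map_add, lie_sub, sub_lie]
      abel
    · simp [h]
  exact sub_eq_zero.1 (LinearMap.congr_fun this y)

end FreeLieAlgebra

namespace BorcherdsAlgebra

variable {I J K : Type*} (A : Matrix I I ℝ) (ord : LinearOrder J) (a : J → I) (b : K → I)

open FreeLieAlgebra NegAlg in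
/-- If the simple roots `a j` are isotropic and mutually orthogonal, while the remaining simple roots
`b k` are orthogonal to no simple root, then the subalgebra of the negative part generated by the
ordered products is free. -/
theorem isFreeFamily_f (hab : Function.Bijective (Sum.elim a b)) (hA : ∀ i, A i i ≤ 0)
    (hs : ∀ i j, A i j = A j i) (hb : ∀ k i, A (b k) i ≠ 0) :
    IsFreeFamily fun x : (J →₀ ℕ) × K =>
      orderedAd ord (fun j => f A (a j)) x.1 (f A (b x.2)) := by
  let L := FreeLieAlgebra ℂ ((J →₀ ℕ) × K)
  -- The derivation `D j` models `ad (f (a j))`, which raises the exponent of `j` by one.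
  let D : J → Module.End ℂ L := fun j => der fun x => of ℂ (x.1 + Finsupp.single j 1, x.2)
  have hDof : ∀ j x, D j (of ℂ x) = of ℂ (x.1 + Finsupp.single j 1, x.2) := fun j x => der_of _ x
  have hDD : ∀ i j y, D i (D j y) = D j (D i y) := fun i j y => der_comm (fun x => by
    simp [add_right_comm]) y
  have hDe : ∀ j y, D j (euler y) = euler (D j y) := fun j y => der_comm (fun x => by simp) y
  let Δ : J → Module.End ℂ (ℂ × L) := fun j => LinearMap.inr ℂ ℂ L ∘ₗ D j ∘ₗ LinearMap.snd ℂ ℂ L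
  have hΔ : ∀ j p, Δ j p = (0, D j p.2) := fun j p => rfl
  -- The Euler cocycle makes `T` faithful, since `T y (1, 0) = (0, euler y)`. The adjoint
  -- representation alone is not faithful when there is a single letter.
  let T : L →ₗ⁅ℂ⁆ Module.End ℂ (ℂ × L) := derRep (of ℂ)
  have hT : ∀ y p, T y p = (0, p.1 • euler y + ⁅y, p.2⁆) := fun y p => derRep_apply _ y p
  have hΔT : ∀ j y, ⁅Δ j, T y⁆ = T (D j y) := by
    intro j y
    refine LinearMap.ext fun p => ?_
    simp only [LieRing.of_associative_ring_bracket, LinearMap.sub_apply, Module.End.mul_apply, hΔ,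
      hT, map_add, map_smul, hDe, zero_smul, zero_add]
    rw [show D j ⁅y, p.2⁆ = ⁅D j y, p.2⁆ + ⁅y, D j p.2⁆ from der_lie _ _ _]
    simp
    abel
  -- By `hb`, a zero entry of `A` involves only indices of type `a`, so the relations of `NegAlg A`
  -- ask only that the operators `Δ j` commute.
  obtain ⟨ψ, hψ⟩ := exists_lift (A := A)
    (fun i => Sum.elim Δ (fun k => T (of ℂ (0, k))) ((Equiv.ofBijective _ hab).symm i)) (by
      intro i i' hi
      obtain ⟨s, rfl⟩ := (Equiv.ofBijective _ hab).surjective i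
      obtain ⟨s', rfl⟩ := (Equiv.ofBijective _ hab).surjective i'
      simp only [Equiv.symm_apply_apply]
      rcases s with j | k
      · rcases s' with j' | k'
        · refine LinearMap.ext fun p => ?_
          simp [hΔ, hDD j j']
        · exact absurd ((hs _ _).trans hi) (hb k' _)
      · exact absurd hi (hb k _))
  have hψa : ∀ j, ψ (x A (a j)) = Δ j := fun j => by
    rw [hψ, show a j = Equiv.ofBijective _ hab (Sum.inl j) from rfl, Equiv.symm_apply_apply]; rfl
  have hψb : ∀ k, ψ (x A (b k)) = T (of ℂ (0, k)) := fun k => by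
    rw [hψ, show b k = Equiv.ofBijective _ hab (Sum.inr k) from rfl, Equiv.symm_apply_apply]; rfl
  obtain ⟨ρ, hρ⟩ := exists_verma A hA hs
  let φ : L →ₗ⁅ℂ⁆ NegAlg A := FreeLieAlgebra.lift ℂ fun y => orderedAd ord (fun j => x A (a j)) y.1 (x A (b y.2))
  let U : L →ₗ⁅ℂ⁆ BorcherdsAlgebra A :=
    FreeLieAlgebra.lift ℂ fun y => orderedAd ord (fun j => f A (a j)) y.1 (f A (b y.2))
  have h1 : ρ.comp U = (AlgHom.toLieHom (Algebra.lmul ℂ (NegAlg A))).comp φ := by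
    ext1 y
    simp only [LieHom.comp_apply, U, φ, lift_of_apply, LieHom.map_orderedAd, (hρ _).1]
    rfl
  -- By `hΔT` the commutators with `Δ j` shift exponents, so each ordered product goes to `T` of the
  -- matching letter.
  have h2 : (AlgHom.toLieHom ψ).comp φ = T := by
    ext1 y
    simp only [LieHom.comp_apply, φ, lift_of_apply, LieHom.map_orderedAd]
    simp only [AlgHom.coe_toLieHom, hψa, hψb]
    exact orderedAd_eq_of_shift ord (y := fun l => T (of ℂ (l, y.2)))
      (fun j l => by rw [hΔT, hDof]) y.1
  -- If `U z = 0`, then left multiplication by `φ z` kills `1`, hence `φ z = 0` and `T z = 0`; at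
  -- `(1, 0)` this reads `euler z = 0`.
  refine (injective_iff_map_eq_zero U).2 fun z hz => euler_injective ?_
  have h3 : φ z = 0 := by
    have := LinearMap.congr_fun (LieHom.congr_fun h1 z) 1
    simpa [hz] using this.symm
  have h4 := LinearMap.congr_fun (LieHom.congr_fun h2 z) (1, 0)
  simpa [h3, hT] using h4.symm

/-- The involution carries this family to the one built from the `f`, which is free; the first
factor of an injective composite is injective. -/
theorem isFreeFamily_e (hab : Function.Bijective (Sum.elim a b)) (hA : ∀ i, A i i ≤ 0)
    (hs : ∀ i j, A i j = A j i) (hb : ∀ k i, A (b k) i ≠ 0) :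
    IsFreeFamily fun x : (J →₀ ℕ) × K =>
      orderedAd ord (fun j => e A (a j)) x.1 (e A (b x.2)) := by
  obtain ⟨ω, hω⟩ := exists_involution A hA
  have h : ω.comp (FreeLieAlgebra.lift ℂ fun x : (J →₀ ℕ) × K =>
      orderedAd ord (fun j => e A (a j)) x.1 (e A (b x.2))) =
      FreeLieAlgebra.lift ℂ fun x : (J →₀ ℕ) × K =>
      orderedAd ord (fun j => f A (a j)) x.1 (f A (b x.2)) := by
    ext1 y
    simp [LieHom.map_orderedAd, hω]
  have := isFreeFamily_f A ord a b hab hA hs hb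
  unfold IsFreeFamily at this
  rw [← h] at this
  exact Function.Injective.of_comp (f := ω) this

/-- In the Verma module `h_i` fixes the vector `1`, and `1 ≠ 0` because `NegAlg A` has the
augmentation `x_i ↦ 0`. -/
theorem h_ne_zero (hA : ∀ i, A i i ≤ 0) (hs : ∀ i j, A i j = A j i) (i : I) : h A i ≠ 0 := by
  intro h0
  obtain ⟨ρ, hρ⟩ := exists_verma A hA hs
  have h1 := (hρ i).2
  rw [h0, map_zero, LinearMap.zero_apply] at h1
  obtain ⟨ψ, -⟩ := NegAlg.exists_lift (A := A) (fun _ => (0 : ℂ)) (by simp)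
  simpa using congrArg ψ h1

theorem e_ne_zero (hA : ∀ i, A i i ≤ 0) (hs : ∀ i j, A i j = A j i) (i : I) : e A i ≠ 0 := by
  intro h0
  apply h_ne_zero A hA hs i
  rw [← e_lie_f_same, h0, zero_lie]

end BorcherdsAlgebra

end

noncomputable section

/-! ## The exponents of the product expansion -/

/-- A function with a convergent product expansion `q^(-1) ∏ (1 - q^m)^(c m)` at one cusp that
vanishes at the other cusp has infinitely many nonzero exponents: a finite product vanishes only to
finite order as `q → 1`, while the expansion at the other cusp decays exponentially. -/
theorem infinite_exponents {N : ℕ} (hN : 0 < N) {c₀ c₁ : ℕ → ℕ} {F : ℂ → ℂ} {κ : ℂ}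
    (hF : ∀ τ : ℂ, 0 < τ.im →
      HasProd
        (fun m : ℕ =>
          (1 - Complex.exp (2 * Real.pi * Complex.I * τ * ((m : ℂ) + 1))) ^ c₀ (m + 1))
        (Complex.exp (2 * Real.pi * Complex.I * τ) * (F τ + κ)) ∧
      HasSum
        (fun n : ℕ =>
          (c₁ (n + 1) : ℂ) * Complex.exp (2 * Real.pi * Complex.I * τ * (((n : ℂ) + 1) / N)))
        (F (-1 / τ) + κ)) :
    {m : ℕ | 0 < m ∧ c₀ m ≠ 0}.Infinite := by
  intro hfin
  have hN' : (0 : ℝ) < N := by exact_mod_cast hN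
  obtain ⟨S, hS⟩ : ∃ S : Finset ℕ, ∀ m, c₀ (m + 1) ≠ 0 → m ∈ S := by
    refine ⟨hfin.toFinset.image Nat.pred, fun m hm => Finset.mem_image.2 ⟨m + 1, ?_, rfl⟩⟩
    simpa using hm
  set d : ℕ := ∑ m ∈ S, c₀ (m + 1)
  have hpi := Real.pi_pos
  -- At `τ = i/s` one has `q = e^(-u)` with `u = 2π/s`. Every factor is at least `1 - e^(-u) ≥ u
  -- e^(-u) ≥ u e^(-2π)`, where `s ≥ 1` gives `u ≤ 2π`.
  have lower : ∀ s : ℝ, 1 ≤ s →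
      (2 * Real.pi * Real.exp (-(2 * Real.pi)) / s) ^ d ≤ ‖F (Complex.I / s) + κ‖ := by
    intro s hs
    have hs0 : 0 < s := by linarith
    set u : ℝ := 2 * Real.pi / s with hu
    have hu0 : 0 < u := by positivity
    have hu1 : u ≤ 2 * Real.pi := div_le_self (by positivity) hs
    have hτ : 0 < (Complex.I / (s : ℂ)).im := by
      rw [Complex.div_ofReal_im, Complex.I_im]; positivity
    have hq : 2 * Real.pi * Complex.I * (Complex.I / (s : ℂ)) = ((-u : ℝ) : ℂ) := by
      rw [hu]; push_cast
      linear_combination (2 * (Real.pi : ℂ) / s) * Complex.I_mul_I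
    have hP := (hF _ hτ).1
    rw [hq] at hP
    have hP' := hP.unique (hasProd_prod_of_ne_finset_one (s := S) fun m hm => by
      rw [not_not.1 (mt (hS m) hm), pow_zero])
    have hn : ‖F (Complex.I / s) + κ‖ * Real.exp (-u) =
        ∏ m ∈ S, (1 - Real.exp (-u * ((m : ℝ) + 1))) ^ c₀ (m + 1) := by
      have := congrArg norm hP'
      rw [norm_mul, ← Complex.ofReal_exp, Complex.norm_real, Real.norm_of_nonneg (Real.exp_nonneg _),
        norm_prod, mul_comm] at this
      rw [this]
      refine Finset.prod_congr rfl fun m _ => ?_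
      rw [norm_pow]
      congr 1
      have hc : (1 - Complex.exp (((-u : ℝ) : ℂ) * ((m : ℂ) + 1))) =
          ((1 - Real.exp (-u * ((m : ℝ) + 1)) : ℝ) : ℂ) := by push_cast; rfl
      rw [hc, Complex.norm_real, Real.norm_of_nonneg]
      rw [sub_nonneg, Real.exp_le_one_iff]
      have : (0 : ℝ) ≤ u * ((m : ℝ) + 1) := by positivity
      linarith
    have h1 : 2 * Real.pi * Real.exp (-(2 * Real.pi)) / s ≤ 1 - Real.exp (-u) := by
      have e1 : u + 1 ≤ Real.exp u := Real.add_one_le_exp u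
      have e2 : Real.exp (-u) * Real.exp u = 1 := by rw [← Real.exp_add]; simp
      have e3 : Real.exp (-(2 * Real.pi)) ≤ Real.exp (-u) := Real.exp_le_exp.2 (by linarith)
      have e4 : 2 * Real.pi * Real.exp (-(2 * Real.pi)) / s = u * Real.exp (-(2 * Real.pi)) := by
        rw [hu]; ring
      rw [e4]
      nlinarith [mul_le_mul_of_nonneg_left e3 hu0.le,
        mul_le_mul_of_nonneg_left e1 (Real.exp_pos (-u)).le]
    calc (2 * Real.pi * Real.exp (-(2 * Real.pi)) / s) ^ d
        ≤ (1 - Real.exp (-u)) ^ d := pow_le_pow_left₀ (by positivity) h1 d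
      _ = ∏ m ∈ S, (1 - Real.exp (-u)) ^ c₀ (m + 1) := by rw [Finset.prod_pow_eq_pow_sum]
      _ ≤ ∏ m ∈ S, (1 - Real.exp (-u * ((m : ℝ) + 1))) ^ c₀ (m + 1) := by
        have h0 : (0 : ℝ) ≤ 1 - Real.exp (-u) := le_trans (by positivity) h1
        refine Finset.prod_le_prod (fun m _ => pow_nonneg h0 _) fun m _ => ?_
        refine pow_le_pow_left₀ h0 (sub_le_sub_left (Real.exp_le_exp.2 ?_) _) _
        nlinarith [Nat.cast_nonneg (α := ℝ) m]
      _ = ‖F (Complex.I / s) + κ‖ * Real.exp (-u) := hn.symm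
      _ ≤ ‖F (Complex.I / s) + κ‖ :=
        mul_le_of_le_one_right (norm_nonneg _) (Real.exp_le_one_iff.2 (by linarith))
  set b : ℝ := 2 * Real.pi / N with hb
  have hb0 : 0 < b := by positivity
  -- The point `τ = is` has `-1/τ = i/s`, so the second expansion computes the same value; its terms
  -- are nonnegative reals, so it equals its norm.
  have expand : ∀ s : ℝ, 1 ≤ s →
      HasSum (fun n : ℕ => (c₁ (n + 1) : ℝ) * Real.exp (-b * s * (n + 1)))
        ‖F (Complex.I / s) + κ‖ := by
    intro s hs
    have hs0 : 0 < s := by linarith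
    have hτ : 0 < ((s : ℂ) * Complex.I).im := by simpa using hs0
    have hsum := (hF _ hτ).2
    have hinv : -1 / ((s : ℂ) * Complex.I) = Complex.I / s := by
      have : (s : ℂ) ≠ 0 := by exact_mod_cast hs0.ne'
      field_simp
      rw [Complex.I_sq]
    have hterm : (fun n : ℕ => (c₁ (n + 1) : ℂ) *
        Complex.exp (2 * Real.pi * Complex.I * (s * Complex.I) * (((n : ℂ) + 1) / N))) =
        fun n : ℕ => (((c₁ (n + 1) : ℝ) * Real.exp (-b * s * (n + 1)) : ℝ) : ℂ) := by
      funext n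
      push_cast
      congr 2
      rw [hb]; push_cast
      linear_combination (2 * (Real.pi : ℂ) * s * ((n + 1) / N)) * Complex.I_mul_I
    rw [hinv, hterm] at hsum
    have hr := (Complex.summable_ofReal.1 hsum.summable).hasSum
    rw [hsum.unique (Complex.hasSum_ofReal.2 hr), Complex.norm_real,
      Real.norm_of_nonneg (tsum_nonneg fun n => by positivity)]
    exact hr
  set B : ℝ := ‖F (Complex.I / (1 : ℝ)) + κ‖
  -- Termwise, `e^(-bs(n+1)) ≤ e^(-b(s-1)) e^(-b(n+1))`: the series at `s` is bounded by its value
  -- at `1` times an exponential.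
  have upper : ∀ s : ℝ, 1 ≤ s →
      ‖F (Complex.I / s) + κ‖ ≤ Real.exp b * B * Real.exp (-b * s) := by
    intro s hs
    have h1 := (expand 1 le_rfl).mul_left (Real.exp (-b * (s - 1)))
    have h2 : Real.exp b * B * Real.exp (-b * s) = Real.exp (-b * (s - 1)) * B := by
      rw [show -b * (s - 1) = b + -b * s by ring, Real.exp_add]; ring
    rw [h2]
    refine hasSum_le (fun n => ?_) (expand s hs) h1
    rw [mul_left_comm, ← Real.exp_add]
    refine mul_le_mul_of_nonneg_left (Real.exp_le_exp.2 ?_) (Nat.cast_nonneg _)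
    have : 0 ≤ b * (s - 1) * n := by
      have : 0 ≤ s - 1 := by linarith
      positivity
    linarith
  set C : ℝ := 2 * Real.pi * Real.exp (-(2 * Real.pi))
  have hC : 0 < C := by positivity
  -- Both bounds together keep a positive constant below `s^d e^(-bs)`, up to a factor, and this
  -- tends to `0`.
  have key : ∀ s : ℝ, 1 ≤ s →
      C ^ d ≤ Real.exp b * B * (s ^ (d : ℝ) * Real.exp (-b * s)) := by
    intro s hs
    have hs0 : 0 < s ^ d := by positivity
    have h := (lower s hs).trans (upper s hs)
    rw [div_pow, div_le_iff₀ hs0] at h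
    rw [Real.rpow_natCast]
    linarith
  have hlim : Filter.Tendsto
      (fun s : ℝ => Real.exp b * B * (s ^ (d : ℝ) * Real.exp (-b * s))) Filter.atTop (nhds 0) := by
    simpa using (tendsto_rpow_mul_exp_neg_mul_atTop_nhds_zero (d : ℝ) b hb0).const_mul
      (Real.exp b * B)
  have := ge_of_tendsto hlim (Filter.eventually_atTop.2 ⟨1, key⟩)
  exact absurd this (not_le.2 (pow_pos hC d))

/-! ### Elimination of a commuting family of generators -/

section OrderedAd

variable {L : Type*} [LieRing L] [LieAlgebra ℂ L] {J K : Type*} (ord : LinearOrder J)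

theorem orderedAd_induction {P : L → Prop} {x : J → L} (hx : ∀ j z, P z → P ⁅x j, z⁆)
    (l : J →₀ ℕ) {y : L} (hy : P y) : P (orderedAd ord x l y) := by
  unfold orderedAd
  induction (@Finset.sort J l.support (fun a b => a ≤ b) _ _ _ _ : List J) with
  | nil => exact hy
  | cons j t ih =>
    rw [List.foldr_cons]
    generalize List.foldr _ _ t = z at ih
    induction l j with
    | zero => exact ih
    | succ n hn => rw [pow_succ', Module.End.mul_apply]; exact hx j _ hn

@[simp]
theorem orderedAd_zero (x : J → L) (y : L) : orderedAd ord x 0 y = y := by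
  simp [orderedAd]

/-- For commuting `x j`, bracketing with `x j` raises the exponent of `x j`. -/
theorem lie_orderedAd {x : J → L} (hx : ∀ i j, ⁅x i, x j⁆ = 0) (j : J) (l : J →₀ ℕ) (y : L) :
    ⁅x j, orderedAd ord x l y⁆ = orderedAd ord x (l + Finsupp.single j 1) y := by
  classical
  have hcomm : ∀ i j, Commute (LieAlgebra.ad ℂ L (x i)) (LieAlgebra.ad ℂ L (x j)) := by
    intro i j
    refine LinearMap.ext fun z => ?_
    simp only [Module.End.mul_apply, LieAlgebra.ad_apply]
    rw [leibniz_lie, hx, zero_lie, zero_add]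
  -- Since the operators commute, the sorted product may be rearranged to put the factor of `j`
  -- first; it is trivial when `l j = 0`.
  have hl : ∀ l : J →₀ ℕ, orderedAd ord x l y = (LieAlgebra.ad ℂ L (x j) ^ l j)
      ((l.support.erase j).toList.foldr (fun j z => (LieAlgebra.ad ℂ L (x j) ^ l j) z) y) := by
    intro l
    have : LeftCommutative fun (j : J) (z : L) => (LieAlgebra.ad ℂ L (x j) ^ l j) z :=
      ⟨fun i j z => LinearMap.congr_fun ((hcomm i j).pow_pow (l i) (l j)) z⟩
    have hsort : (@Finset.sort J l.support (fun a b => a ≤ b) _ _ _ _).Perm l.support.toList :=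
      (Finset.sort_perm_toList _ _)
    unfold orderedAd
    refine (hsort.foldr_eq y).trans ?_
    by_cases hj : j ∈ l.support
    · have h := Finset.toList_insert (Finset.notMem_erase j l.support)
      rw [Finset.insert_erase hj] at h
      rw [h.foldr_eq, List.foldr_cons]
    · rw [Finset.erase_eq_of_notMem hj, Finsupp.notMem_support_iff.1 hj, pow_zero,
        Module.End.one_apply]
  have hsupp : (l + Finsupp.single j 1).support.erase j = l.support.erase j := by
    ext i
    simp only [Finset.mem_erase, Finsupp.mem_support_iff, Finsupp.add_apply, ne_eq,
      and_congr_right_iff]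
    intro hi
    rw [Finsupp.single_eq_of_ne hi, add_zero]
  rw [hl, hl (l + _), hsupp, Finsupp.add_apply, Finsupp.single_eq_same, pow_succ',
    Module.End.mul_apply, LieAlgebra.ad_apply]
  congr 2
  refine List.foldr_ext _ _ _ fun i hi z => ?_
  rw [Finsupp.add_apply, Finsupp.single_eq_of_ne
    (Finset.ne_of_mem_erase (Finset.mem_toList.1 hi)), add_zero]

/-- Elimination: the Lie algebra generated by commuting elements `x j` and by elements `y k` is spanned
by the `x j` and by the Lie algebra generated by the ordered products. -/
theorem lieSpan_le_span_sup_lieSpan_orderedAd {x : J → L} (hx : ∀ i j, ⁅x i, x j⁆ = 0) (y : K → L) :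
    (LieSubalgebra.lieSpan ℂ L (Set.range x ∪ Set.range y)).toSubmodule ≤
      Submodule.span ℂ (Set.range x) ⊔ (LieSubalgebra.lieSpan ℂ L
        (Set.range fun p : (J →₀ ℕ) × K => orderedAd ord x p.1 (y p.2))).toSubmodule := by
  set u := LieSubalgebra.lieSpan ℂ L
    (Set.range fun p : (J →₀ ℕ) × K => orderedAd ord x p.1 (y p.2))
  -- Raising an exponent turns one generator of `u` into another, so `ad (x j)` preserves `u` by the
  -- Leibniz rule.
  have hxu : ∀ j, ∀ z ∈ u, ⁅x j, z⁆ ∈ u := by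
    intro j z hz
    induction hz using LieSubalgebra.lieSpan_induction with
    | mem z hz =>
      obtain ⟨p, rfl⟩ := hz
      exact LieSubalgebra.subset_lieSpan
        ⟨(p.1 + Finsupp.single j 1, p.2), (lie_orderedAd ord hx j p.1 _).symm⟩
    | zero => simp
    | add z w _ _ hz hw => rw [lie_add]; exact u.add_mem hz hw
    | smul a z _ hz => rw [lie_smul]; exact u.smul_mem _ hz
    | lie z w hz' hw' hz hw =>
      rw [leibniz_lie]
      exact u.add_mem (u.lie_mem hz hw') (u.lie_mem hz' hw)
  have hsu : ∀ w ∈ Submodule.span ℂ (Set.range x), ∀ z ∈ u, ⁅w, z⁆ ∈ u := by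
    intro w hw z hz
    induction hw using Submodule.span_induction with
    | mem w hw => obtain ⟨j, rfl⟩ := hw; exact hxu j z hz
    | zero => simp
    | add v w _ _ hv hw => rw [add_lie]; exact u.add_mem hv hw
    | smul a w _ hw => rw [smul_lie]; exact u.smul_mem _ hw
  have hss : ∀ w ∈ Submodule.span ℂ (Set.range x), ∀ z ∈ Submodule.span ℂ (Set.range x),
      ⁅w, z⁆ = 0 := by
    intro w hw z hz
    induction hw, hz using Submodule.span_induction₂ with
    | mem_mem w z hw hz =>
      obtain ⟨i, rfl⟩ := hw
      obtain ⟨j, rfl⟩ := hz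
      exact hx i j
    | zero_left z hz => simp
    | zero_right w hw => simp
    | add_left v w z _ _ _ h1 h2 => rw [add_lie, h1, h2, add_zero]
    | add_right v w z _ _ _ h1 h2 => rw [lie_add, h1, h2, add_zero]
    | smul_left r w z _ _ h => rw [smul_lie, h, smul_zero]
    | smul_right r w z _ _ h => rw [lie_smul, h, smul_zero]
  let P : LieSubalgebra ℂ L :=
    { Submodule.span ℂ (Set.range x) ⊔ u.toSubmodule with
      lie_mem' := by
        intro p q hp hq
        obtain ⟨p₁, hp₁, p₂, hp₂, rfl⟩ := Submodule.mem_sup.1 hp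
        obtain ⟨q₁, hq₁, q₂, hq₂, rfl⟩ := Submodule.mem_sup.1 hq
        refine Submodule.mem_sup_right ?_
        -- The span of the `x j` is abelian and normalises `u`, so every bracket lands in `u`.
        have h : ⁅p₁ + p₂, q₁ + q₂⁆ = ⁅p₁, q₂⁆ + (-⁅q₁, p₂⁆ + ⁅p₂, q₂⁆) := by
          rw [add_lie, lie_add, lie_add, hss _ hp₁ _ hq₁, zero_add, lie_skew]
        rw [h]
        exact u.add_mem (hsu _ hp₁ _ hq₂) (u.add_mem (u.neg_mem (hsu _ hq₁ _ hp₂))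
          (u.lie_mem hp₂ hq₂)) }
  have : LieSubalgebra.lieSpan ℂ L (Set.range x ∪ Set.range y) ≤ P := by
    refine LieSubalgebra.lieSpan_le.2 ?_
    rintro _ (⟨j, rfl⟩ | ⟨k, rfl⟩)
    · exact Submodule.mem_sup_left (Submodule.subset_span ⟨j, rfl⟩)
    · exact Submodule.mem_sup_right (LieSubalgebra.subset_lieSpan ⟨(0, k), by simp⟩)
  exact this

end OrderedAd

/-! ## Triangular decomposition -/

section Triangular

variable {L : Type*} [LieRing L] [LieAlgebra ℂ L]

theorem lie_mem_lieSpan_of_forall {s : Set L} {h : L}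
    (hs : ∀ x ∈ s, ⁅h, x⁆ ∈ LieSubalgebra.lieSpan ℂ L s) :
    ∀ x ∈ LieSubalgebra.lieSpan ℂ L s, ⁅h, x⁆ ∈ LieSubalgebra.lieSpan ℂ L s := by
  intro x hx
  set n := LieSubalgebra.lieSpan ℂ L s
  induction hx using LieSubalgebra.lieSpan_induction with
  | mem x hx => exact hs x hx
  | zero => simp
  | add x y _ _ hx hy => rw [lie_add]; exact n.add_mem hx hy
  | smul a x _ hx => rw [lie_smul]; exact n.smul_mem _ hx
  | lie x y hx' hy' hx hy =>
    rw [leibniz_lie]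
    exact n.add_mem (n.lie_mem hx hy') (n.lie_mem hx' hy)

/-- This is the step `[e_i, 𝔫⁻] ⊆ 𝔥 + 𝔫⁻`: in `[[t, x], y] + [x, [t, y]]` the inner brackets lie in
the span of `c` plus the subalgebra, and this sum normalises the subalgebra. -/
theorem lie_mem_span_sup_lieSpan {s c : Set L} {t : L}
    (hc : ∀ h ∈ c, ∀ x ∈ s, ⁅h, x⁆ ∈ LieSubalgebra.lieSpan ℂ L s)
    (ht : ∀ x ∈ s, ⁅t, x⁆ ∈ Submodule.span ℂ c) :
    ∀ x ∈ LieSubalgebra.lieSpan ℂ L s,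
      ⁅t, x⁆ ∈ Submodule.span ℂ c ⊔ (LieSubalgebra.lieSpan ℂ L s).toSubmodule := by
  set n := LieSubalgebra.lieSpan ℂ L s
  have hcn : ∀ h ∈ Submodule.span ℂ c ⊔ n.toSubmodule, ∀ x ∈ n, ⁅h, x⁆ ∈ n := by
    intro h hh x hx
    obtain ⟨h₁, h₁', h₂, h₂', rfl⟩ := Submodule.mem_sup.1 hh
    rw [add_lie]
    refine n.add_mem ?_ (n.lie_mem h₂' hx)
    induction h₁' using Submodule.span_induction with
    | mem w hw => exact lie_mem_lieSpan_of_forall (hc w hw) x hx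
    | zero => simp
    | add v w hv' hw' hv hw =>
      rw [add_lie]
      exact n.add_mem (hv (Submodule.add_mem_sup hv' h₂')) (hw (Submodule.add_mem_sup hw' h₂'))
    | smul a w hw' hw => rw [smul_lie]; exact n.smul_mem _ (hw (Submodule.add_mem_sup hw' h₂'))
  intro x hx
  induction hx using LieSubalgebra.lieSpan_induction with
  | mem x hx => exact Submodule.mem_sup_left (ht x hx)
  | zero => simp
  | add x y _ _ hx hy => rw [lie_add]; exact Submodule.add_mem _ hx hy
  | smul a x _ hx => rw [lie_smul]; exact Submodule.smul_mem _ _ hx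
  | lie x y hx' hy' hx hy =>
    rw [leibniz_lie, ← lie_skew x]
    exact Submodule.mem_sup_right (n.add_mem (hcn _ hx _ hy') (n.neg_mem (hcn _ hy _ hx')))

namespace BorcherdsAlgebra

variable {I : Type*} (A : Matrix I I ℝ)

/-- The sum contains all generators and is stable under bracketing with each of them. Only spanning
is needed here; directness comes later from eigenvalues. -/
theorem triangular :
    (LieSubalgebra.lieSpan ℂ (BorcherdsAlgebra A) (Set.range (f A))).toSubmodule ⊔
      Submodule.span ℂ (Set.range (h A)) ⊔
      (LieSubalgebra.lieSpan ℂ (BorcherdsAlgebra A) (Set.range (e A))).toSubmodule = ⊤ := by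
  set P := LieSubalgebra.lieSpan ℂ (BorcherdsAlgebra A) (Set.range (e A))
  set M := LieSubalgebra.lieSpan ℂ (BorcherdsAlgebra A) (Set.range (f A))
  have eP : ∀ i, e A i ∈ P := fun i => LieSubalgebra.subset_lieSpan ⟨i, rfl⟩
  have fM : ∀ i, f A i ∈ M := fun i => LieSubalgebra.subset_lieSpan ⟨i, rfl⟩
  have hh : ∀ i, h A i ∈ Submodule.span ℂ (Set.range (h A)) := fun i =>
    Submodule.subset_span ⟨i, rfl⟩
  have hP : ∀ y ∈ Set.range (h A), ∀ x ∈ Set.range (e A), ⁅y, x⁆ ∈ P := by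
    rintro _ ⟨i, rfl⟩ _ ⟨j, rfl⟩
    rw [h_lie_e]
    exact P.smul_mem _ (eP j)
  have hM : ∀ y ∈ Set.range (h A), ∀ x ∈ Set.range (f A), ⁅y, x⁆ ∈ M := by
    rintro _ ⟨i, rfl⟩ _ ⟨j, rfl⟩
    rw [h_lie_f]
    exact M.neg_mem (M.smul_mem _ (fM j))
  have ef : ∀ i j, ⁅e A i, f A j⁆ ∈ Submodule.span ℂ (Set.range (h A)) := by
    intro i j
    by_cases hij : i = j
    · subst hij; rw [e_lie_f_same]; exact hh i
    · rw [e_lie_f_ne A hij]; exact Submodule.zero_mem _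
  have ePM : ∀ i, ∀ x ∈ M, ⁅e A i, x⁆ ∈ Submodule.span ℂ (Set.range (h A)) ⊔ M.toSubmodule :=
    fun i => lie_mem_span_sup_lieSpan hM (by rintro _ ⟨j, rfl⟩; exact ef i j)
  have fMP : ∀ i, ∀ x ∈ P, ⁅f A i, x⁆ ∈ Submodule.span ℂ (Set.range (h A)) ⊔ P.toSubmodule :=
    fun i => lie_mem_span_sup_lieSpan hP (by
      rintro _ ⟨j, rfl⟩; rw [← lie_skew]; exact Submodule.neg_mem _ (ef j i))
  have span_le : ∀ (g : BorcherdsAlgebra A) (Q : Submodule ℂ (BorcherdsAlgebra A)),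
      (∀ i, ⁅g, h A i⁆ ∈ Q) → ∀ y ∈ Submodule.span ℂ (Set.range (h A)), ⁅g, y⁆ ∈ Q := by
    intro g Q hg y hy
    have : Submodule.span ℂ (Set.range (h A)) ≤ Q.comap (LieAlgebra.ad ℂ _ g) :=
      Submodule.span_le.2 (by rintro _ ⟨i, rfl⟩; exact hg i)
    exact this hy
  refine eq_top_of_stable A ?_ ?_
  · rintro (i | i | i)
    · exact Submodule.mem_sup_right (eP i)
    · exact Submodule.mem_sup_left (Submodule.mem_sup_left (fM i))
    · exact Submodule.mem_sup_left (Submodule.mem_sup_right (hh i))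
  · intro s w hw
    obtain ⟨w', hw', p, hp, rfl⟩ := Submodule.mem_sup.1 hw
    obtain ⟨m, hm, y, hy, rfl⟩ := Submodule.mem_sup.1 hw'
    have hlie : ⁅gen A s, m + y + p⁆ = ⁅gen A s, m⁆ + ⁅gen A s, y⁆ + ⁅gen A s, p⁆ :=
      (lie_add (gen A s) (m + y) p).trans
        (congrArg (· + ⁅gen A s, p⁆) (lie_add (gen A s) m y))
    rw [hlie]
    have le₁ : Submodule.span ℂ (Set.range (h A)) ⊔ M.toSubmodule ≤
        M.toSubmodule ⊔ Submodule.span ℂ (Set.range (h A)) ⊔ P.toSubmodule := by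
      rw [sup_comm (Submodule.span ℂ _)]; exact le_sup_left
    have le₂ : Submodule.span ℂ (Set.range (h A)) ⊔ P.toSubmodule ≤
        M.toSubmodule ⊔ Submodule.span ℂ (Set.range (h A)) ⊔ P.toSubmodule :=
      sup_le_sup_right le_sup_right _
    have leM : M.toSubmodule ≤
        M.toSubmodule ⊔ Submodule.span ℂ (Set.range (h A)) ⊔ P.toSubmodule :=
      le_sup_right.trans le₁
    have leP : P.toSubmodule ≤
        M.toSubmodule ⊔ Submodule.span ℂ (Set.range (h A)) ⊔ P.toSubmodule := le_sup_right
    refine Submodule.add_mem _ (Submodule.add_mem _ ?_ ?_) ?_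
    · rcases s with i | i | i
      · exact le₁ (ePM i m hm)
      · exact leM (M.lie_mem (fM i) hm)
      · exact leM (lie_mem_lieSpan_of_forall (hM _ ⟨i, rfl⟩) m hm)
    · rcases s with i | i | i
      · refine leP (span_le _ _ (fun j => ?_) y hy)
        change ⁅e A i, h A j⁆ ∈ P
        rw [← lie_skew]
        exact P.neg_mem (hP _ ⟨j, rfl⟩ _ ⟨i, rfl⟩)
      · refine leM (span_le _ _ (fun j => ?_) y hy)
        change ⁅f A i, h A j⁆ ∈ M
        rw [← lie_skew]
        exact M.neg_mem (hM _ ⟨j, rfl⟩ _ ⟨i, rfl⟩)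
      · refine leP (span_le _ _ (fun j => ?_) y hy)
        change ⁅h A i, h A j⁆ ∈ P
        rw [h_lie_h]
        exact P.zero_mem
    · rcases s with i | i | i
      · exact leP (P.lie_mem (eP i) hp)
      · exact le₂ (fMP i p hp)
      · exact leP (lie_mem_lieSpan_of_forall (hP _ ⟨i, rfl⟩) p hp)

end BorcherdsAlgebra

end Triangular

/-! ## Heisenberg Lie algebras -/

section Heisenberg

variable {L : Type*} [LieRing L] [LieAlgebra ℂ L] {J : Type*}

/-- Families `E`, `F` and an element `Z` that satisfy Heisenberg relations. -/
structure HeisenbergTriple (E F : J → L) (Z : L) (c : J → ℂ) : Prop where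
  E_E : ∀ i j, ⁅E i, E j⁆ = 0
  F_F : ∀ i j, ⁅F i, F j⁆ = 0
  E_F_same : ∀ i, ⁅E i, F i⁆ = c i • Z
  E_F_ne : ∀ i j, i ≠ j → ⁅E i, F j⁆ = 0
  Z_E : ∀ i, ⁅Z, E i⁆ = 0
  Z_F : ∀ i, ⁅Z, F i⁆ = 0
  c_ne_zero : ∀ i, c i ≠ 0
  Z_ne_zero : Z ≠ 0

namespace HeisenbergTriple

variable {E F : J → L} {Z : L} {c : J → ℂ}

theorem lie_mem (t : HeisenbergTriple E F Z c) {x y : L}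
    (hx : x ∈ Submodule.span ℂ (Set.range E ∪ Set.range F ∪ {Z}))
    (hy : y ∈ Submodule.span ℂ (Set.range E ∪ Set.range F ∪ {Z})) :
    ⁅x, y⁆ ∈ Submodule.span ℂ {Z} := by
  have hEF : ∀ i j, ⁅E i, F j⁆ ∈ Submodule.span ℂ {Z} := by
    intro i j
    by_cases hij : i = j
    · subst hij
      rw [t.E_F_same]
      exact Submodule.smul_mem _ _ (Submodule.mem_span_singleton_self Z)
    · rw [t.E_F_ne i j hij]
      exact Submodule.zero_mem _
  induction hx, hy using Submodule.span_induction₂ with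
  | mem_mem x y hx hy =>
    rcases hx with (⟨i, rfl⟩ | ⟨i, rfl⟩) | hx <;> rcases hy with (⟨j, rfl⟩ | ⟨j, rfl⟩) | hy
    · rw [t.E_E]; exact Submodule.zero_mem _
    · exact hEF i j
    · rw [Set.mem_singleton_iff.1 hy, ← lie_skew, t.Z_E, neg_zero]; exact Submodule.zero_mem _
    · rw [← lie_skew]; exact Submodule.neg_mem _ (hEF j i)
    · rw [t.F_F]; exact Submodule.zero_mem _
    · rw [Set.mem_singleton_iff.1 hy, ← lie_skew, t.Z_F, neg_zero]; exact Submodule.zero_mem _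
    · rw [Set.mem_singleton_iff.1 hx, t.Z_E]; exact Submodule.zero_mem _
    · rw [Set.mem_singleton_iff.1 hx, t.Z_F]; exact Submodule.zero_mem _
    · rw [Set.mem_singleton_iff.1 hx, Set.mem_singleton_iff.1 hy, lie_self]
      exact Submodule.zero_mem _
  | zero_left y hy => simp
  | zero_right x hx => simp
  | add_left x y z _ _ _ h1 h2 => rw [add_lie]; exact Submodule.add_mem _ h1 h2
  | add_right x y z _ _ _ h1 h2 => rw [lie_add]; exact Submodule.add_mem _ h1 h2
  | smul_left r x y _ _ h => rw [smul_lie]; exact Submodule.smul_mem _ _ h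
  | smul_right r x y _ _ h => rw [lie_smul]; exact Submodule.smul_mem _ _ h

/-- The Heisenberg Lie algebra spanned by `E`, `F` and `Z`. -/
def subalgebra (t : HeisenbergTriple E F Z c) : LieSubalgebra ℂ L where
  toSubmodule := Submodule.span ℂ (Set.range E ∪ Set.range F ∪ {Z})
  lie_mem' := fun hx hy =>
    Submodule.span_mono (Set.subset_union_right) (t.lie_mem hx hy)

theorem E_mem (t : HeisenbergTriple E F Z c) (j : J) : E j ∈ t.subalgebra :=
  Submodule.subset_span (.inl (.inl ⟨j, rfl⟩))

theorem F_mem (t : HeisenbergTriple E F Z c) (j : J) : F j ∈ t.subalgebra :=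
  Submodule.subset_span (.inl (.inr ⟨j, rfl⟩))

theorem Z_mem (t : HeisenbergTriple E F Z c) : Z ∈ t.subalgebra :=
  Submodule.subset_span (.inr rfl)

theorem lie_Z (t : HeisenbergTriple E F Z c) {x : L} (hx : x ∈ t.subalgebra) : ⁅x, Z⁆ = 0 := by
  have : Submodule.span ℂ (Set.range E ∪ Set.range F ∪ {Z}) ≤
      LinearMap.ker (LieAlgebra.ad ℂ L Z) := by
    refine Submodule.span_le.2 ?_
    rintro _ ((⟨i, rfl⟩ | ⟨i, rfl⟩) | rfl)
    · exact t.Z_E i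
    · exact t.Z_F i
    · exact lie_self _
  have h : ⁅Z, x⁆ = 0 := this hx
  rw [← lie_skew, h, neg_zero]

theorem lie_E_sum (t : HeisenbergTriple E F Z c) (a : J →₀ ℂ) (j : J) :
    ⁅a.sum fun i r => r • E i, F j⁆ = (a j * c j) • Z := by
  rw [Finsupp.sum, sum_lie, Finset.sum_eq_single j]
  · rw [smul_lie, t.E_F_same, mul_smul]
  · intro i _ hi
    rw [smul_lie, t.E_F_ne i j hi, smul_zero]
  · intro hj
    rw [Finsupp.notMem_support_iff.1 hj, zero_smul, zero_lie]

theorem lie_F_sum (t : HeisenbergTriple E F Z c) (b : J →₀ ℂ) (j : J) :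
    ⁅E j, b.sum fun i r => r • F i⁆ = (b j * c j) • Z := by
  rw [Finsupp.sum, lie_sum, Finset.sum_eq_single j]
  · rw [lie_smul, t.E_F_same, mul_smul]
  · intro i _ hi
    rw [lie_smul, t.E_F_ne j i hi.symm, smul_zero]
  · intro hj
    rw [Finsupp.notMem_support_iff.1 hj, zero_smul, lie_zero]

theorem lie_E_E_sum (t : HeisenbergTriple E F Z c) (a : J →₀ ℂ) (j : J) :
    ⁅E j, a.sum fun i r => r • E i⁆ = 0 := by
  rw [Finsupp.sum, lie_sum]
  exact Finset.sum_eq_zero fun i _ => by rw [lie_smul, t.E_E, smul_zero]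

theorem lie_F_F_sum (t : HeisenbergTriple E F Z c) (b : J →₀ ℂ) (j : J) :
    ⁅b.sum fun i r => r • F i, F j⁆ = 0 := by
  rw [Finsupp.sum, sum_lie]
  exact Finset.sum_eq_zero fun i _ => by rw [smul_lie, t.F_F, smul_zero]

theorem coeff_eq_zero (t : HeisenbergTriple E F Z c) {r : ℂ} {j : J} (h : (r * c j) • Z = 0) :
    r = 0 := by
  simpa [t.Z_ne_zero, t.c_ne_zero j] using h

/-- Bracketing with `F j` and `E j` reads off the coefficients of `E j` and `F j`, up to the nonzero
factor `c j`. -/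
theorem mem_span_Z (t : HeisenbergTriple E F Z c) {x : L} (hx : x ∈ t.subalgebra)
    (hE : ∀ j, ⁅E j, x⁆ = 0) (hF : ∀ j, ⁅x, F j⁆ = 0) : x ∈ Submodule.span ℂ {Z} := by
  have hx' : x ∈ Submodule.span ℂ (Set.range E ∪ Set.range F ∪ {Z}) := hx
  rw [Submodule.span_union, Submodule.span_union] at hx'
  obtain ⟨y, hy, z, hz, rfl⟩ := Submodule.mem_sup.1 hx'
  obtain ⟨v, hv, w, hw, rfl⟩ := Submodule.mem_sup.1 hy
  obtain ⟨a, rfl⟩ := Finsupp.mem_span_range_iff_exists_finsupp.1 hv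
  obtain ⟨b, rfl⟩ := Finsupp.mem_span_range_iff_exists_finsupp.1 hw
  obtain ⟨s, rfl⟩ := Submodule.mem_span_singleton.1 hz
  have ha : a = 0 := by
    ext j
    have := hF j
    rw [add_lie, add_lie, t.lie_E_sum, t.lie_F_F_sum, smul_lie, t.Z_F, smul_zero, add_zero,
      add_zero] at this
    exact t.coeff_eq_zero this
  have hb : b = 0 := by
    ext j
    have := hE j
    rw [lie_add, lie_add, t.lie_E_E_sum, t.lie_F_sum, lie_smul, t.lie_Z (t.E_mem j), smul_zero,
      add_zero, zero_add] at this
    exact t.coeff_eq_zero this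
  subst ha hb
  simpa using Submodule.smul_mem _ s (Submodule.mem_span_singleton_self Z)

theorem mem_center_iff (t : HeisenbergTriple E F Z c) (x : t.subalgebra) :
    x ∈ LieAlgebra.center ℂ t.subalgebra ↔ (x : L) ∈ Submodule.span ℂ {Z} := by
  rw [LieModule.mem_maxTrivSubmodule]
  constructor
  · intro h
    refine t.mem_span_Z x.2 (fun j => ?_) fun j => ?_
    · exact congrArg Subtype.val (h ⟨E j, t.E_mem j⟩)
    · have : ⁅F j, (x : L)⁆ = 0 := congrArg Subtype.val (h ⟨F j, t.F_mem j⟩)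
      rw [← lie_skew, this, neg_zero]
  · intro hx y
    obtain ⟨s, hs⟩ := Submodule.mem_span_singleton.1 hx
    refine Subtype.ext ?_
    rw [LieSubalgebra.coe_bracket, ← hs, lie_smul, t.lie_Z y.2, smul_zero]
    rfl

theorem map_center (t : HeisenbergTriple E F Z c) :
    (LieAlgebra.center ℂ t.subalgebra).toSubmodule.map t.subalgebra.toSubmodule.subtype =
      Submodule.span ℂ {Z} := by
  ext x
  constructor
  · rintro ⟨y, hy, rfl⟩
    exact (t.mem_center_iff y).1 hy
  · intro hx
    have hxH : x ∈ t.subalgebra := by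
      obtain ⟨s, rfl⟩ := Submodule.mem_span_singleton.1 hx
      exact t.subalgebra.smul_mem s t.Z_mem
    exact ⟨⟨x, hxH⟩, (t.mem_center_iff ⟨x, hxH⟩).2 hx, rfl⟩

theorem isHeisenberg [Nonempty J] (t : HeisenbergTriple E F Z c) : IsHeisenberg t.subalgebra where
  derived_eq_center := by
    refine le_antisymm ?_ fun x hx => ?_
    · refine (LieSubmodule.lie_le_iff _ _ _).2 fun x _ y _ => ?_
      exact (t.mem_center_iff _).2 (t.lie_mem x.2 y.2)
    · obtain ⟨s, hs⟩ := Submodule.mem_span_singleton.1 ((t.mem_center_iff x).1 hx)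
      obtain ⟨j⟩ := ‹Nonempty J›
      have hx' : x = (s * (c j)⁻¹) •
          ⁅(⟨E j, t.E_mem j⟩ : t.subalgebra), (⟨F j, t.F_mem j⟩ : t.subalgebra)⁆ := by
        refine Subtype.ext ?_
        rw [← hs]
        change s • Z = (s * (c j)⁻¹) • ⁅E j, F j⁆
        rw [t.E_F_same, smul_smul, inv_mul_cancel_right₀ (t.c_ne_zero j)]
      rw [hx']
      exact Submodule.smul_mem _ _ (LieSubmodule.lie_mem_lie trivial trivial)
  finrank_center := by
    rw [← finrank_span_singleton (K := ℂ) t.Z_ne_zero, ← t.map_center]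
    exact (LinearEquiv.finrank_eq (Submodule.equivMapOfInjective _
      (Submodule.subtype_injective _) _))

theorem linearIndependent_E (t : HeisenbergTriple E F Z c) : LinearIndependent ℂ E := by
  refine linearIndependent_iff.2 fun a ha => ?_
  ext j
  have h := t.lie_E_sum a j
  rw [Finsupp.linearCombination_apply] at ha
  rw [ha, zero_lie] at h
  exact t.coeff_eq_zero h.symm

theorem not_finiteDimensional [Infinite J] (t : HeisenbergTriple E F Z c) :
    ¬ FiniteDimensional ℂ t.subalgebra := by
  intro hfin
  have h : LinearIndependent ℂ fun j => (⟨E j, t.E_mem j⟩ : t.subalgebra) :=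
    LinearIndependent.of_comp t.subalgebra.toSubmodule.subtype t.linearIndependent_E
  have := h.finite
  exact not_finite J

end HeisenbergTriple

end Heisenberg

/-! ### Separating the summands by the sign of an eigenvalue -/

section Eigen

variable {W : Type*} [AddCommGroup W] [Module ℂ W]

theorem eigenSum_mono (T : Module.End ℂ W) {S S' : Set ℂ} (h : S ⊆ S') :
    eigenSum T S ≤ eigenSum T S' :=
  Submodule.span_mono fun _ ⟨μ, hμ, hx⟩ => ⟨μ, h hμ, hx⟩

theorem map_eigenSum_ad_le {L L' : Type*} [LieRing L] [LieAlgebra ℂ L] [LieRing L']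
    [LieAlgebra ℂ L'] (φ : L →ₗ⁅ℂ⁆ L') (h : L) (S : Set ℂ) :
    (eigenSum (LieAlgebra.ad ℂ L h) S).map (φ : L →ₗ[ℂ] L') ≤
      eigenSum (LieAlgebra.ad ℂ L' (φ h)) S := by
  refine (Submodule.map_span_le _ _ _).2 ?_
  rintro x ⟨μ, hμ, hx⟩
  refine mem_eigenSum hμ ?_
  rw [LieAlgebra.ad_apply] at hx
  change ⁅φ h, φ x⁆ = μ • φ x
  rw [← LieHom.map_lie, hx, map_smul]

/-- Four subspaces that span form a direct sum decomposition, if the first and the last are separated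
from the disjoint two in the middle by the sign of the eigenvalues of an operator. -/
theorem isInternal_of_eigenSum {T : Module.End ℂ W} {M₀ M₁ M₂ M₃ : Submodule ℂ W}
    (h₀ : M₀ ≤ eigenSum T {μ | 0 < μ.re}) (h₁ : M₁ ≤ eigenSum T {0}) (h₂ : M₂ ≤ eigenSum T {0})
    (h₃ : M₃ ≤ eigenSum T {μ | μ.re < 0}) (h₁₂ : Disjoint M₁ M₂)
    (htop : M₀ ⊔ M₁ ⊔ M₂ ⊔ M₃ = ⊤) : DirectSum.IsInternal ![M₀, M₁, M₂, M₃] := by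
  have key : ∀ x₀ ∈ M₀, ∀ x₁ ∈ M₁, ∀ x₂ ∈ M₂, ∀ x₃ ∈ M₃, x₀ + x₁ + x₂ + x₃ = 0 →
      x₀ = 0 ∧ x₁ = 0 ∧ x₂ = 0 ∧ x₃ = 0 := by
    intro x₀ hx₀ x₁ hx₁ x₂ hx₂ x₃ hx₃ h
    have d₁ : Disjoint {μ : ℂ | 0 < μ.re} {μ : ℂ | μ.re ≤ 0} :=
      Set.disjoint_left.2 fun μ (h : 0 < μ.re) (h' : μ.re ≤ 0) => by linarith
    have d₂ : Disjoint {μ : ℂ | μ.re < 0} {(0 : ℂ)} := by simp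
    have le₀ : eigenSum T {0} ≤ eigenSum T {μ | μ.re ≤ 0} := eigenSum_mono T (by simp)
    have le₁ : eigenSum T {μ | μ.re < 0} ≤ eigenSum T {μ | μ.re ≤ 0} :=
      eigenSum_mono T fun μ (h : μ.re < 0) => h.le
    have e₀ : x₀ = 0 := by
      refine Submodule.disjoint_def.1 (disjoint_eigenSum T d₁) x₀ (h₀ hx₀) ?_
      rw [show x₀ = -(x₁ + x₂ + x₃) by rw [← sub_eq_zero, sub_neg_eq_add, ← h]; abel]
      exact Submodule.neg_mem _ (Submodule.add_mem _ (Submodule.add_mem _ (le₀ (h₁ hx₁))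
        (le₀ (h₂ hx₂))) (le₁ (h₃ hx₃)))
    subst e₀
    rw [zero_add] at h
    have e₃ : x₃ = 0 := by
      refine Submodule.disjoint_def.1 (disjoint_eigenSum T d₂) x₃ (h₃ hx₃) ?_
      rw [show x₃ = -(x₁ + x₂) by rw [← sub_eq_zero, sub_neg_eq_add, ← h]; abel]
      exact Submodule.neg_mem _ (Submodule.add_mem _ (h₁ hx₁) (h₂ hx₂))
    subst e₃
    rw [add_zero] at h
    have e₁ : x₁ = 0 := by
      refine Submodule.disjoint_def.1 h₁₂ x₁ hx₁ ?_
      rw [eq_neg_of_add_eq_zero_left h]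
      exact Submodule.neg_mem _ hx₂
    subst e₁
    rw [zero_add] at h
    exact ⟨rfl, rfl, h, rfl⟩
  rw [DirectSum.isInternal_submodule_iff_iSupIndep_and_iSup_eq_top]
  constructor
  · rw [iSupIndep_iff_finsetSum_eq_zero_imp_eq_zero]
    intro s v hv hsum i hi
    classical
    -- Extension by zero outside `s` reduces a partial sum to a sum of four vectors.
    let w : Fin 4 → W := fun i => if i ∈ s then v i else 0
    have hw : ∀ i, w i ∈ (![M₀, M₁, M₂, M₃] : Fin 4 → Submodule ℂ W) i := by
      intro i
      by_cases h : i ∈ s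
      · simpa only [w, h, if_true] using hv i h
      · simp only [w, h, if_false, Submodule.zero_mem]
    have hw' : ∑ i, w i = 0 := by
      rw [← hsum, Finset.sum_ite_mem, Finset.univ_inter]
    rw [Fin.sum_univ_four] at hw'
    have h := key _ (hw 0) _ (hw 1) _ (hw 2) _ (hw 3) hw'
    have hwi : w i = 0 := by
      fin_cases i
      exacts [h.1, h.2.1, h.2.2.1, h.2.2.2]
    simpa only [w, hi, if_true] using hwi
  · refine eq_top_iff.2 (htop ▸ ?_)
    exact sup_le (sup_le (sup_le (le_iSup ![M₀, M₁, M₂, M₃] 0) (le_iSup ![M₀, M₁, M₂, M₃] 1))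
      (le_iSup ![M₀, M₁, M₂, M₃] 2)) (le_iSup ![M₀, M₁, M₂, M₃] 3)

end Eigen

namespace BorcherdsAlgebra

variable {I J K : Type*} (A : Matrix I I ℝ) (ord : LinearOrder J) {a : J → I} {b : K → I}

/-- The starting vector `e (b k)` has a strictly negative eigenvalue, and each factor `ad (e (a j))`
adds a nonpositive one; negativity is preserved by brackets. -/
theorem lieSpan_orderedAd_e_le_eigenSum {i : I} (ha : ∀ j, A i (a j) ≤ 0)
    (hb : ∀ k, A i (b k) < 0) :
    (LieSubalgebra.lieSpan ℂ (BorcherdsAlgebra A) (Set.range fun x : (J →₀ ℕ) × K =>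
      orderedAd ord (fun j => e A (a j)) x.1 (e A (b x.2)))).toSubmodule ≤
      eigenSum (LieAlgebra.ad ℂ _ (h A i)) {μ | μ.re < 0} := by
  refine lieSpan_le_eigenSum (fun x y => ?_) (fun μ hμ ν hν => ?_) ?_
  · exact leibniz_lie (h A i) x y
  · change (μ + ν).re < 0
    rw [Complex.add_re]
    exact add_neg hμ hν
  · rintro _ ⟨x, rfl⟩
    refine orderedAd_induction ord (P := fun z => ∃ μ ∈ {μ : ℂ | μ.re < 0},
      LieAlgebra.ad ℂ _ (h A i) z = μ • z) ?_ _ ?_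
    · rintro j z ⟨μ, hμ, hz⟩
      refine ⟨A i (a j) + μ, ?_, ?_⟩
      · change ((A i (a j) : ℂ) + μ).re < 0
        rw [Complex.add_re, Complex.ofReal_re]
        exact add_neg_of_nonpos_of_neg (ha j) hμ
      · rw [LieAlgebra.ad_apply] at hz ⊢
        rw [leibniz_lie, hz, h_lie_e, smul_lie, lie_smul, add_smul]
    · exact ⟨A i (b x.2), by simpa using hb x.2, h_lie_e A _ _⟩

theorem lieSpan_orderedAd_f_le_eigenSum {i : I} (ha : ∀ j, A i (a j) ≤ 0)
    (hb : ∀ k, A i (b k) < 0) :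
    (LieSubalgebra.lieSpan ℂ (BorcherdsAlgebra A) (Set.range fun x : (J →₀ ℕ) × K =>
      orderedAd ord (fun j => f A (a j)) x.1 (f A (b x.2)))).toSubmodule ≤
      eigenSum (LieAlgebra.ad ℂ _ (h A i)) {μ | 0 < μ.re} := by
  refine lieSpan_le_eigenSum (fun x y => ?_) (fun μ hμ ν hν => ?_) ?_
  · exact leibniz_lie (h A i) x y
  · change 0 < (μ + ν).re
    rw [Complex.add_re]
    exact add_pos hμ hν
  · rintro _ ⟨x, rfl⟩
    refine orderedAd_induction ord (P := fun z => ∃ μ ∈ {μ : ℂ | 0 < μ.re},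
      LieAlgebra.ad ℂ _ (h A i) z = μ • z) ?_ _ ?_
    · rintro j z ⟨μ, hμ, hz⟩
      refine ⟨-A i (a j) + μ, ?_, ?_⟩
      · change 0 < (-(A i (a j) : ℂ) + μ).re
        rw [Complex.add_re, Complex.neg_re, Complex.ofReal_re]
        exact add_pos_of_nonneg_of_pos (neg_nonneg.2 (ha j)) hμ
      · rw [LieAlgebra.ad_apply] at hz ⊢
        rw [leibniz_lie, hz, h_lie_f, neg_lie, smul_lie, lie_smul, add_smul, neg_smul]
    · refine ⟨-A i (b x.2), by simpa using hb x.2, ?_⟩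
      rw [LieAlgebra.ad_apply, h_lie_f, neg_smul]

end BorcherdsAlgebra

theorem modCenterMap_surjective (L : Type*) [LieRing L] [LieAlgebra ℂ L] :
    Function.Surjective (modCenterMap L) :=
  LieSubmodule.Quotient.surjective_mk' _

theorem modCenterMap_eq_zero_iff {L : Type*} [LieRing L] [LieAlgebra ℂ L] {x : L} :
    modCenterMap L x = 0 ↔ x ∈ LieAlgebra.center ℂ L :=
  LieSubmodule.Quotient.mk_eq_zero (N := LieAlgebra.center ℂ L)

/-- The projection to the quotient by the center is injective where some `ad h` has no eigenvalue
zero. -/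
theorem injOn_modCenterMap {L : Type*} [LieRing L] [LieAlgebra ℂ L] {u : Submodule ℂ L} {h : L}
    {S : Set ℂ} (hS : (0 : ℂ) ∉ S) (hu : u ≤ eigenSum (LieAlgebra.ad ℂ L h) S) :
    Set.InjOn (modCenterMap L) u := by
  intro x hx y hy hxy
  rw [← sub_eq_zero, ← map_sub, modCenterMap_eq_zero_iff, LieModule.mem_maxTrivSubmodule] at hxy
  exact sub_eq_zero.1 (eq_zero_of_mem_eigenSum hS (hu (u.sub_mem hx hy)) (hxy h))

/-! ### The matrix `A_g` and the structure of `𝔪_g` -/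

namespace Monstrous

open BorcherdsAlgebra

variable {c₀ c₁ : ℕ → ℕ}

theorem minus_neg (j : IMinus c₀) : j.1.1 < 0 := by
  obtain ⟨m, hm, h, -⟩ := j.2
  omega

theorem plus_pos (i : IPlus c₁) : 0 < i.1.1 := by
  obtain ⟨n, hn, h, -⟩ := i.2
  omega

theorem bijective_elim : Function.Bijective (Sum.elim (ofMinus c₀ c₁) (ofPlus c₀ c₁)) := by
  constructor
  · rintro (j | i) (j' | i') h
    · exact congrArg Sum.inl (Subtype.ext (Subtype.ext_iff.1 h :))
    · have h1 : j.1 = i'.1 := congrArg Subtype.val h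
      have := minus_neg j
      have := plus_pos i'
      rw [h1] at *
      omega
    · have h1 : i.1 = j'.1 := congrArg Subtype.val h
      have := minus_neg j'
      have := plus_pos i
      rw [h1] at *
      omega
    · exact congrArg Sum.inr (Subtype.ext (Subtype.ext_iff.1 h :))
  · rintro ⟨p, hp | hp⟩
    · exact ⟨.inl ⟨p, hp⟩, rfl⟩
    · exact ⟨.inr ⟨p, hp⟩, rfl⟩

@[simp]
theorem cartan_minus_minus (j j' : IMinus c₀) :
    cartan c₀ c₁ (ofMinus c₀ c₁ j) (ofMinus c₀ c₁ j') = 0 := by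
  simp [cartan, ofMinus, (minus_neg j), (minus_neg j')]

@[simp]
theorem cartan_minus_plus (j : IMinus c₀) (i : IPlus c₁) :
    cartan c₀ c₁ (ofMinus c₀ c₁ j) (ofPlus c₀ c₁ i) = (j.1.1 : ℝ) * i.1.1 := by
  simp [cartan, ofMinus, ofPlus, (minus_neg j), (plus_pos i).not_gt]

@[simp]
theorem cartan_plus_minus (i : IPlus c₁) (j : IMinus c₀) :
    cartan c₀ c₁ (ofPlus c₀ c₁ i) (ofMinus c₀ c₁ j) = (i.1.1 : ℝ) * j.1.1 := by
  simp [cartan, ofMinus, ofPlus, (minus_neg j), (plus_pos i).not_gt]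

@[simp]
theorem cartan_plus_plus (i i' : IPlus c₁) :
    cartan c₀ c₁ (ofPlus c₀ c₁ i) (ofPlus c₀ c₁ i') = -((i.1.1 : ℝ) + i'.1.1) := by
  simp [cartan, ofPlus, (plus_pos i).not_gt, (plus_pos i').not_gt]

theorem forall_index {P : Index c₀ c₁ → Prop} (h₁ : ∀ j, P (ofMinus c₀ c₁ j))
    (h₂ : ∀ i, P (ofPlus c₀ c₁ i)) (p) : P p := by
  obtain ⟨s, rfl⟩ := bijective_elim.2 p
  cases s with
  | inl j => exact h₁ j
  | inr i => exact h₂ i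

theorem cartan_symm (p q : Index c₀ c₁) : cartan c₀ c₁ p q = cartan c₀ c₁ q p := by
  induction p using forall_index <;> induction q using forall_index <;> simp [mul_comm, add_comm]

/-- Strict negativity of the rows from `I₊` serves three times: no relation involves these
generators, the eigenvalues on `𝔲^±` have a strict sign, and no `h_p` is central. -/
theorem cartan_plus_neg (i : IPlus c₁) (p : Index c₀ c₁) :
    cartan c₀ c₁ (ofPlus c₀ c₁ i) p < 0 := by
  have hi : (0 : ℝ) < i.1.1 := by exact_mod_cast (plus_pos i)
  induction p using forall_index with
  | h₁ j =>
    have hj : (j.1.1 : ℝ) < 0 := by exact_mod_cast (minus_neg j)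
    rw [cartan_plus_minus]
    exact mul_neg_of_pos_of_neg hi hj
  | h₂ i' =>
    have hi' : (0 : ℝ) < i'.1.1 := by exact_mod_cast (plus_pos i')
    rw [cartan_plus_plus]
    linarith

theorem cartan_nonpos (p q : Index c₀ c₁) : cartan c₀ c₁ p q ≤ 0 := by
  induction p using forall_index with
  | h₁ j =>
    induction q using forall_index with
    | h₁ j' => simp
    | h₂ i => rw [cartan_symm]; exact (cartan_plus_neg i _).le
  | h₂ i => exact (cartan_plus_neg i q).le

theorem e_ne_zero (p : Index c₀ c₁) : e (cartan c₀ c₁) p ≠ 0 :=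
  BorcherdsAlgebra.e_ne_zero _ (fun i => cartan_nonpos i i) cartan_symm p

theorem uPlus_le_eigenSum (ord : LinearOrder (IMinus c₀)) (p : Index c₀ c₁) :
    (uPlus c₀ c₁ ord).toSubmodule ≤
      eigenSum (LieAlgebra.ad ℂ _ (h (cartan c₀ c₁) p)) {μ | μ.re < 0} :=
  lieSpan_orderedAd_e_le_eigenSum _ ord (fun _ => cartan_nonpos _ _)
    fun i => cartan_symm p _ ▸ cartan_plus_neg i p

theorem uMinus_le_eigenSum (ord : LinearOrder (IMinus c₀)) (p : Index c₀ c₁) :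
    (uMinus c₀ c₁ ord).toSubmodule ≤
      eigenSum (LieAlgebra.ad ℂ _ (h (cartan c₀ c₁) p)) {μ | 0 < μ.re} :=
  lieSpan_orderedAd_f_le_eigenSum _ ord (fun _ => cartan_nonpos _ _)
    fun i => cartan_symm p _ ▸ cartan_plus_neg i p

theorem range_eq_union {L : Type*} (x : Index c₀ c₁ → L) :
    Set.range x = Set.range (fun j => x (ofMinus c₀ c₁ j)) ∪
      Set.range (fun i => x (ofPlus c₀ c₁ i)) := by
  refine Set.Subset.antisymm ?_ ?_
  · rintro _ ⟨p, rfl⟩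
    induction p using forall_index with
    | h₁ j => exact .inl ⟨j, rfl⟩
    | h₂ i => exact .inr ⟨i, rfl⟩
  · rintro _ (⟨j, rfl⟩ | ⟨i, rfl⟩) <;> exact ⟨_, rfl⟩

theorem lieSpan_e_le (ord : LinearOrder (IMinus c₀)) :
    (LieSubalgebra.lieSpan ℂ (Alg c₀ c₁) (Set.range (e (cartan c₀ c₁)))).toSubmodule ≤
      Submodule.span ℂ (Set.range fun j => e (cartan c₀ c₁) (ofMinus c₀ c₁ j)) ⊔
        (uPlus c₀ c₁ ord).toSubmodule := by
  rw [range_eq_union]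
  exact lieSpan_le_span_sup_lieSpan_orderedAd ord (fun i j => e_lie_e (cartan_minus_minus i j)) _

theorem lieSpan_f_le (ord : LinearOrder (IMinus c₀)) :
    (LieSubalgebra.lieSpan ℂ (Alg c₀ c₁) (Set.range (f (cartan c₀ c₁)))).toSubmodule ≤
      Submodule.span ℂ (Set.range fun j => f (cartan c₀ c₁) (ofMinus c₀ c₁ j)) ⊔
        (uMinus c₀ c₁ ord).toSubmodule := by
  rw [range_eq_union]
  exact lieSpan_le_span_sup_lieSpan_orderedAd ord (fun i j => f_lie_f (cartan_minus_minus i j)) _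

/-! ### Relations in the quotient by the center -/

theorem eBar_lie_fBar_same (p : Index c₀ c₁) : ⁅eBar c₀ c₁ p, fBar c₀ c₁ p⁆ = hBar c₀ c₁ p := by
  rw [eBar, fBar, hBar, ← LieHom.map_lie, e_lie_f_same]

theorem eBar_lie_fBar_ne {p q : Index c₀ c₁} (h : p ≠ q) : ⁅eBar c₀ c₁ p, fBar c₀ c₁ q⁆ = 0 := by
  rw [eBar, fBar, ← LieHom.map_lie, e_lie_f_ne _ h, map_zero]

theorem hBar_lie_eBar (p q : Index c₀ c₁) :
    ⁅hBar c₀ c₁ p, eBar c₀ c₁ q⁆ = (cartan c₀ c₁ p q : ℂ) • eBar c₀ c₁ q := by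
  rw [eBar, hBar, ← LieHom.map_lie, h_lie_e, map_smul]

theorem hBar_lie_fBar (p q : Index c₀ c₁) :
    ⁅hBar c₀ c₁ p, fBar c₀ c₁ q⁆ = -((cartan c₀ c₁ p q : ℂ) • fBar c₀ c₁ q) := by
  rw [fBar, hBar, ← LieHom.map_lie, h_lie_f, map_neg, map_smul]

theorem hBar_lie_hBar (p q : Index c₀ c₁) : ⁅hBar c₀ c₁ p, hBar c₀ c₁ q⁆ = 0 := by
  rw [hBar, hBar, ← LieHom.map_lie, h_lie_h, map_zero]

theorem eBar_lie_eBar {p q : Index c₀ c₁} (h : cartan c₀ c₁ p q = 0) :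
    ⁅eBar c₀ c₁ p, eBar c₀ c₁ q⁆ = 0 := by
  rw [eBar, eBar, ← LieHom.map_lie, e_lie_e h, map_zero]

theorem fBar_lie_fBar {p q : Index c₀ c₁} (h : cartan c₀ c₁ p q = 0) :
    ⁅fBar c₀ c₁ p, fBar c₀ c₁ q⁆ = 0 := by
  rw [fBar, fBar, ← LieHom.map_lie, f_lie_f h, map_zero]

/-- A central `h_p` would annihilate `e_i`, but `[h_p, e_i]` is a nonzero multiple of the nonzero
vector `e_i`. -/
theorem hBar_ne_zero (p : Index c₀ c₁) (i : IPlus c₁) : hBar c₀ c₁ p ≠ 0 := by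
  intro h0
  have hc := modCenterMap_eq_zero_iff.1 h0
  rw [LieModule.mem_maxTrivSubmodule] at hc
  have h1 := hc (e (cartan c₀ c₁) (ofPlus c₀ c₁ i))
  rw [← lie_skew, h_lie_e, neg_eq_zero] at h1
  refine (smul_ne_zero ?_ (e_ne_zero _)) h1
  rw [cartan_symm]
  exact_mod_cast (cartan_plus_neg i p).ne

/-- A linear dependence between rows of the matrix holds between the `h p` modulo the center. -/
theorem hBar_eq_of_row {p q r : Index c₀ c₁} {β γ : ℂ}
    (h : ∀ s, (cartan c₀ c₁ p s : ℂ) = β * cartan c₀ c₁ q s + γ * cartan c₀ c₁ r s) :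
    hBar c₀ c₁ p = β • hBar c₀ c₁ q + γ • hBar c₀ c₁ r := by
  have hc : BorcherdsAlgebra.h (cartan c₀ c₁) p - (β • BorcherdsAlgebra.h (cartan c₀ c₁) q +
      γ • BorcherdsAlgebra.h (cartan c₀ c₁) r) ∈ LieAlgebra.center ℂ (Alg c₀ c₁) := by
    refine mem_center_of_gen _ ?_
    rintro (s | s | s)
    · change ⁅e (cartan c₀ c₁) s, _⁆ = 0
      rw [← lie_skew, sub_lie, add_lie, smul_lie, smul_lie, h_lie_e, h_lie_e, h_lie_e, h s]
      module
    · change ⁅f (cartan c₀ c₁) s, _⁆ = 0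
      rw [← lie_skew, sub_lie, add_lie, smul_lie, smul_lie, h_lie_f, h_lie_f, h_lie_f, h s]
      module
    · change ⁅BorcherdsAlgebra.h (cartan c₀ c₁) s, _⁆ = 0
      rw [← lie_skew, sub_lie, add_lie, smul_lie, smul_lie, h_lie_h, h_lie_h, h_lie_h]
      simp
  have h0 := modCenterMap_eq_zero_iff.2 hc
  rw [map_sub, map_add, map_smul, map_smul] at h0
  exact sub_eq_zero.1 h0

/-- The row of `(-m, j)` is `-m` times a row independent of `m`, so these rows are proportional. -/
theorem hBar_minus (j j' : IMinus c₀) :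
    hBar c₀ c₁ (ofMinus c₀ c₁ j) =
      ((j.1.1 : ℂ) / j'.1.1) • hBar c₀ c₁ (ofMinus c₀ c₁ j') := by
  have hj' : (j'.1.1 : ℂ) ≠ 0 := by exact_mod_cast (minus_neg j').ne
  have := hBar_eq_of_row (p := ofMinus c₀ c₁ j) (q := ofMinus c₀ c₁ j')
    (r := ofMinus c₀ c₁ j') (β := (j.1.1 : ℂ) / j'.1.1) (γ := 0) (by
      intro s
      induction s using forall_index with
      | h₁ j => simp
      | h₂ i =>
        rw [cartan_minus_plus, cartan_minus_plus]
        push_cast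
        field_simp
        ring)
  rwa [zero_smul, add_zero] at this

/-- Subtracting `n` times the row of `(1, 1)` from that of `(n, k)` cancels the columns in `I₋` and
leaves `(n - 1) n'` in the column `(n', k')`, a multiple of a row from `I₋`. -/
theorem hBar_plus (i i₁ : IPlus c₁) (hi₁ : i₁.1.1 = 1) (j : IMinus c₀) :
    hBar c₀ c₁ (ofPlus c₀ c₁ i) = (i.1.1 : ℂ) • hBar c₀ c₁ (ofPlus c₀ c₁ i₁) +
      (((i.1.1 : ℂ) - 1) / j.1.1) • hBar c₀ c₁ (ofMinus c₀ c₁ j) := by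
  have hj : (j.1.1 : ℂ) ≠ 0 := by exact_mod_cast (minus_neg j).ne
  refine hBar_eq_of_row fun s => ?_
  induction s using forall_index with
  | h₁ j => simp [hi₁]
  | h₂ i' =>
    rw [cartan_plus_plus, cartan_plus_plus, cartan_minus_plus, hi₁]
    push_cast
    field_simp
    ring

theorem heisenbergTriple (j₀ : IMinus c₀) (i₁ : IPlus c₁) :
    HeisenbergTriple (fun j => eBar c₀ c₁ (ofMinus c₀ c₁ j)) (fun j => fBar c₀ c₁ (ofMinus c₀ c₁ j))
      (hBar c₀ c₁ (ofMinus c₀ c₁ j₀)) (fun j => (j.1.1 : ℂ) / j₀.1.1) where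
  E_E i j := eBar_lie_eBar (cartan_minus_minus i j)
  F_F i j := fBar_lie_fBar (cartan_minus_minus i j)
  E_F_same i := by rw [eBar_lie_fBar_same, hBar_minus i j₀]
  E_F_ne i j hij := eBar_lie_fBar_ne fun h =>
    hij (Sum.inl_injective (bijective_elim (c₀ := c₀) (c₁ := c₁).1 (a₁ := .inl i) (a₂ := .inl j) h))
  Z_E i := by rw [hBar_lie_eBar, cartan_minus_minus]; simp
  Z_F i := by rw [hBar_lie_fBar, cartan_minus_minus]; simp
  c_ne_zero i := div_ne_zero (by exact_mod_cast (minus_neg i).ne) (by exact_mod_cast (minus_neg j₀).ne)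
  Z_ne_zero := hBar_ne_zero _ i₁

/-- Brackets inside the Heisenberg algebra lie in the line of `Z`, whereas `h_(1,1)` scales `e_(j₀)`
by a nonzero number. A common nonzero vector would put `e_(j₀)` in that line, against `[e_(j₀),
f_(j₀)] ≠ 0`. -/
theorem disjoint_heisenberg (j₀ : IMinus c₀) (i₁ : IPlus c₁) :
    Disjoint (heisenbergTriple j₀ i₁).subalgebra.toSubmodule
      (Submodule.span ℂ {hBar c₀ c₁ (ofPlus c₀ c₁ i₁)}) := by
  set t := heisenbergTriple j₀ i₁
  rw [Submodule.disjoint_def]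
  intro x hx hx'
  obtain ⟨r, rfl⟩ := Submodule.mem_span_singleton.1 hx'
  by_cases hr : r = 0
  · rw [hr, zero_smul]
  exfalso
  have h1 := t.lie_mem hx (t.E_mem j₀)
  rw [smul_lie, hBar_lie_eBar, smul_smul] at h1
  have hne : r * (cartan c₀ c₁ (ofPlus c₀ c₁ i₁) (ofMinus c₀ c₁ j₀) : ℂ) ≠ 0 :=
    mul_ne_zero hr (by exact_mod_cast (cartan_plus_neg i₁ _).ne)
  obtain ⟨s, hs⟩ := Submodule.mem_span_singleton.1 ((Submodule.smul_mem_iff _ hne).1 h1)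
  have h2 := t.E_F_same j₀
  rw [← hs, smul_lie, t.Z_F, smul_zero] at h2
  exact smul_ne_zero (t.c_ne_zero j₀) t.Z_ne_zero h2.symm

/-- The triangular decomposition is projected to `𝔪_g`; elimination handles its two outer parts and
the row dependences the Cartan part. -/
theorem sup_eq_top (ord : LinearOrder (IMinus c₀)) (j₀ : IMinus c₀) (i₁ : IPlus c₁)
    (hi₁ : i₁.1.1 = 1) :
    ((uMinus c₀ c₁ ord).map (proj c₀ c₁)).toSubmodule ⊔
      (heisenbergTriple j₀ i₁).subalgebra.toSubmodule ⊔
      Submodule.span ℂ {hBar c₀ c₁ (ofPlus c₀ c₁ i₁)} ⊔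
      ((uPlus c₀ c₁ ord).map (proj c₀ c₁)).toSubmodule = ⊤ := by
  set t := heisenbergTriple j₀ i₁
  set S := ((uMinus c₀ c₁ ord).map (proj c₀ c₁)).toSubmodule ⊔ t.subalgebra.toSubmodule ⊔
      Submodule.span ℂ {hBar c₀ c₁ (ofPlus c₀ c₁ i₁)} ⊔
      ((uPlus c₀ c₁ ord).map (proj c₀ c₁)).toSubmodule with hS
  have leU : ((uMinus c₀ c₁ ord).map (proj c₀ c₁)).toSubmodule ≤ S :=
    le_sup_left.trans (le_sup_left.trans le_sup_left)
  have leH : t.subalgebra.toSubmodule ≤ S := le_sup_right.trans (le_sup_left.trans le_sup_left)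
  have leh : Submodule.span ℂ {hBar c₀ c₁ (ofPlus c₀ c₁ i₁)} ≤ S := le_sup_right.trans le_sup_left
  have leP : ((uPlus c₀ c₁ ord).map (proj c₀ c₁)).toSubmodule ≤ S := le_sup_right
  have key : (⊤ : Submodule ℂ (Alg c₀ c₁)) ≤ S.comap (proj c₀ c₁ : Alg c₀ c₁ →ₗ[ℂ] MLie c₀ c₁) := by
    rw [← triangular (cartan c₀ c₁)]
    refine sup_le (sup_le ((lieSpan_f_le ord).trans (sup_le ?_ ?_)) ?_)
      ((lieSpan_e_le ord).trans (sup_le ?_ ?_))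
    · refine Submodule.span_le.2 ?_
      rintro _ ⟨j, rfl⟩
      exact leH (t.F_mem j)
    · exact fun x hx => leU ⟨x, hx, rfl⟩
    · refine Submodule.span_le.2 ?_
      rintro _ ⟨p, rfl⟩
      change hBar c₀ c₁ p ∈ S
      induction p using forall_index with
      | h₁ j =>
        rw [hBar_minus j j₀]
        exact S.smul_mem _ (leH t.Z_mem)
      | h₂ i =>
        rw [hBar_plus i i₁ hi₁ j₀]
        exact S.add_mem (S.smul_mem _ (leh (Submodule.mem_span_singleton_self _)))
          (S.smul_mem _ (leH t.Z_mem))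
    · refine Submodule.span_le.2 ?_
      rintro _ ⟨j, rfl⟩
      exact leH (t.E_mem j)
    · exact fun x hx => leP ⟨x, hx, rfl⟩
  refine eq_top_iff.2 fun y _ => ?_
  obtain ⟨x, rfl⟩ := modCenterMap_surjective (Alg c₀ c₁) y
  exact key (Submodule.mem_top (x := x))

theorem isInternal (ord : LinearOrder (IMinus c₀)) (j₀ : IMinus c₀) (i₁ : IPlus c₁)
    (hi₁ : i₁.1.1 = 1) :
    DirectSum.IsInternal
      ![((uMinus c₀ c₁ ord).map (proj c₀ c₁)).toSubmodule,
        (heisenbergTriple j₀ i₁).subalgebra.toSubmodule,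
        Submodule.span ℂ {hBar c₀ c₁ (ofPlus c₀ c₁ i₁)},
        ((uPlus c₀ c₁ ord).map (proj c₀ c₁)).toSubmodule] := by
  refine isInternal_of_eigenSum
    (T := LieAlgebra.ad ℂ (MLie c₀ c₁) (hBar c₀ c₁ (ofMinus c₀ c₁ j₀))) ?_ ?_ ?_ ?_
    (disjoint_heisenberg j₀ i₁) (sup_eq_top ord j₀ i₁ hi₁)
  · exact (Submodule.map_mono (uMinus_le_eigenSum ord (ofMinus c₀ c₁ j₀))).trans
      (map_eigenSum_ad_le (proj c₀ c₁) _ _)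
  · intro x hx
    refine mem_eigenSum (Set.mem_singleton 0) ?_
    rw [LieAlgebra.ad_apply, ← lie_skew, (heisenbergTriple j₀ i₁).lie_Z hx, neg_zero, zero_smul]
  · refine (Submodule.span_singleton_le_iff_mem _ _).2 (mem_eigenSum (Set.mem_singleton 0) ?_)
    rw [LieAlgebra.ad_apply, hBar_lie_hBar, zero_smul]
  · exact (Submodule.map_mono (uPlus_le_eigenSum ord (ofMinus c₀ c₁ j₀))).trans
      (map_eigenSum_ad_le (proj c₀ c₁) _ _)

theorem infinite_IMinus (h : {m : ℕ | 0 < m ∧ c₀ m ≠ 0}.Infinite) : Infinite (IMinus c₀) := by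
  have := h.to_subtype
  refine Infinite.of_injective (fun m : {m : ℕ | 0 < m ∧ c₀ m ≠ 0} =>
    (⟨(-(m.1 : ℤ), 1), m.1, m.2.1, rfl, le_rfl,
      Int.ofNat_le.2 (Nat.one_le_iff_ne_zero.2 m.2.2)⟩ : IMinus c₀)) fun m n hmn => ?_
  have h1 : -(m.1 : ℤ) = -(n.1 : ℤ) := congrArg (fun x : IMinus c₀ => x.1.1) hmn
  exact Subtype.ext (by omega)

end Monstrous

end

theorem theorem4p3 {V : Type*} [AddCommGroup V] [Module ℂ V] (𝒱 : VertexOperatorAlgebra V)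
    (_h𝒱 : 𝒱.IsMoonshineModule) (g : 𝒱.automorphismGroup) (_hg : ¬ 𝒱.IsFricke g)
    (N : ℕ) (c₀ c₁ : ℕ → ℕ) (_hc : 𝒱.IsMonstrousPair g N c₀ c₁)
    (ord : LinearOrder (Monstrous.IMinus c₀)) :
    ∃ (ℓ : ℕ) (jℓ : Monstrous.IMinus c₀) (i₁ : Monstrous.IPlus c₁)
      (H : LieSubalgebra ℂ (Monstrous.MLie c₀ c₁)),
      IsLeast {m : ℕ | 0 < m ∧ c₀ m ≠ 0} ℓ ∧ jℓ.1 = (-(ℓ : ℤ), 1) ∧ i₁.1 = (1, 1) ∧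
      -- `𝔲⁺` and `𝔲⁻` are free on `U⁺` and `U⁻`, and embed in `𝔪_g`
      IsFreeFamily (Monstrous.UPlus c₀ c₁ ord) ∧
      IsFreeFamily (Monstrous.UMinus c₀ c₁ ord) ∧
      Set.InjOn (Monstrous.proj c₀ c₁) (Monstrous.uPlus c₀ c₁ ord) ∧
      Set.InjOn (Monstrous.proj c₀ c₁) (Monstrous.uMinus c₀ c₁ ord) ∧
      -- `H` is the span of the `e_i`, `f_i` with `i ∈ I₋` and of `h_(-ℓ,1)`
      H.toSubmodule = Submodule.span ℂ
        (Set.range (fun j => Monstrous.eBar c₀ c₁ (Monstrous.ofMinus c₀ c₁ j)) ∪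
          Set.range (fun j => Monstrous.fBar c₀ c₁ (Monstrous.ofMinus c₀ c₁ j)) ∪
          {Monstrous.hBar c₀ c₁ (Monstrous.ofMinus c₀ c₁ jℓ)}) ∧
      -- `H` is an infinite-dimensional Heisenberg Lie algebra with center `ℂ h_(-ℓ,1)`
      IsHeisenberg H ∧
      ¬ FiniteDimensional ℂ H ∧
      (LieAlgebra.center ℂ H).toSubmodule.map H.toSubmodule.subtype =
        Submodule.span ℂ {Monstrous.hBar c₀ c₁ (Monstrous.ofMinus c₀ c₁ jℓ)} ∧
      -- the decomposition of `𝔪_g`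
      Monstrous.hBar c₀ c₁ (Monstrous.ofPlus c₀ c₁ i₁) ≠ 0 ∧
      DirectSum.IsInternal
        ![((Monstrous.uMinus c₀ c₁ ord).map (Monstrous.proj c₀ c₁)).toSubmodule,
          H.toSubmodule,
          Submodule.span ℂ {Monstrous.hBar c₀ c₁ (Monstrous.ofPlus c₀ c₁ i₁)},
          ((Monstrous.uPlus c₀ c₁ ord).map (Monstrous.proj c₀ c₁)).toSubmodule] := by
  have hinf := infinite_exponents _hc.pos _hc.expansions.choose_spec
  have : Infinite (Monstrous.IMinus c₀) := Monstrous.infinite_IMinus hinf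
  have hex : ∃ m, 0 < m ∧ c₀ m ≠ 0 := hinf.nonempty
  classical
  have hleast : IsLeast {m : ℕ | 0 < m ∧ c₀ m ≠ 0} (Nat.find hex) :=
    ⟨Nat.find_spec hex, fun m hm => Nat.find_min' hex hm⟩
  -- Minimality of `ℓ` only selects a generator of the center: all `h_i` with `i ∈ I₋` are
  -- proportional in `𝔪_g`.
  generalize Nat.find hex = ℓ at hleast
  let jℓ : Monstrous.IMinus c₀ := ⟨(-(ℓ : ℤ), 1), ℓ, hleast.1.1, rfl, le_rfl,
    Int.ofNat_le.2 (Nat.one_le_iff_ne_zero.2 hleast.1.2)⟩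
  let i₁ : Monstrous.IPlus c₁ := ⟨(1, 1), 1, one_pos, rfl, le_rfl,
    Int.ofNat_le.2 (Nat.one_le_iff_ne_zero.2 _hc.first_ne_zero)⟩
  have t := Monstrous.heisenbergTriple jℓ i₁
  refine ⟨ℓ, jℓ, i₁, t.subalgebra, hleast, rfl, rfl, ?_, ?_, ?_, ?_, rfl, t.isHeisenberg,
    t.not_finiteDimensional, t.map_center, Monstrous.hBar_ne_zero _ i₁,
    Monstrous.isInternal ord jℓ i₁ rfl⟩
  · exact BorcherdsAlgebra.isFreeFamily_e _ ord _ _ Monstrous.bijective_elim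
      (fun i => Monstrous.cartan_nonpos i i) Monstrous.cartan_symm
      fun k i => (Monstrous.cartan_plus_neg k i).ne
  · exact BorcherdsAlgebra.isFreeFamily_f _ ord _ _ Monstrous.bijective_elim
      (fun i => Monstrous.cartan_nonpos i i) Monstrous.cartan_symm
      fun k i => (Monstrous.cartan_plus_neg k i).ne
  · exact injOn_modCenterMap (by simp)
      (Monstrous.uPlus_le_eigenSum ord (Monstrous.ofPlus c₀ c₁ i₁))
  · exact injOn_modCenterMap (by simp)
      (Monstrous.uMinus_le_eigenSum ord (Monstrous.ofPlus c₀ c₁ i₁))
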